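/- Fix $m$. Let $\mathrm{TrP}_m^0$ be the algebra of scalar-valued trace polynomials in self-adjoint variables $X_1,\dots,X_m$, i.e. the symmetric algebra of $\mathbb{C}\langle X_1,\dots,X_m\rangle/\operatorname{span}\{pq-qp\}$, spanned by the products $\tau(p_1)\cdots\tau(p_n)$ ($p_i$ non-commutative polynomials), and let $\mathrm{TrP}_m^1=\mathrm{TrP}_m^0\otimes\mathbb{C}\langle X_1,\dots,X_m\rangle$. They are evaluated at a self-adjoint tuple of a tracial von Neumann algebra by replacing the formal symbol $\tau$ by the trace; on $M_N(\mathbb{C})$ ($N\ge1$) the trace is $\tau_N=\frac1N\operatorname{Tr}$. Let $D_j:\mathrm{TrP}_m^0\to\mathrm{TrP}_m^1$ be the derivation with $D_j\,\tau(p)=\mathcal{D}_j^\circ p$, where $\mathcal{D}_j^\circ[X_{i_1}\cdots X_{i_n}]=\sum_{k:\,i_k=j}X_{i_{k+1}}\cdots X_{i_n}X_{i_1}\cdots X_{i_{k-1}}$, and $Df=(D_1f,\dots,D_mf)$. For tuples of matrices write $\|x\|_\infty=\max_j\|x_j\|$ (operator norm), $\langle x,y\rangle_2=\sum_j\tau_N(x_jy_j)$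 for self-adjoint $x,y$, and $\|y\|_2=\big(\sum_j\tau_N(y_j^*y_j)\big)^{1/2}$. Put $$\|f\|_R=\limsup_{N\to\infty}\sup_{x\in M_N(\mathbb{C})_{sa}^m,\ \|x\|_\infty\le R}|f(x)|,\qquad \|Df\|_R=\limsup_{N\to\infty}\sup_{x\in M_N(\mathbb{C})_{sa}^m,\ \|x\|_\infty\le R}\|Df(x)\|_2,$$ and let $\mathcal{T}_m^{0,1}$ be the completion of $\mathrm{TrP}_m^0$ for $$d(f,g)=\sum_{n\ge1}2^{-n}\big[\min(1,\|f-g\|_n)+\min(1,\|Df-Dg\|_n)\big].$$ Let $\mathcal{R}$ be the hyperfinite $\mathrm{II}_1$ factor, $\omega$ a free ultrafilter on $\mathbb{N}$ and $\mathcal{R}^\omega$ the tracial ultrapower. An element $f\in\mathcal{T}_m^{0,1}$ defines functions on each $M_N(\mathbb{C})_{sa}^m$ and on $(\mathcal{R}^\omega_{sa})^m$, and $Df$ on each $M_N(\mathbb{C})_{sa}^m$, as limits of the values of approximating trace polynomials; $f$ is real-valued if its values are real. Let $f\in\mathcal{T}_m^{0,1}$ be real-valued. The following are equivalent: 1. $f|_{M_N(\mathbb{C})_{sa}^m}$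 is convex for every $N\ge1$. 2. $f$ is convex as a function on $(\mathcal{R}^\omega_{sa})^m$. 3. There is a sequence of differentiable convex functions $V_N:M_N(\mathbb{C})_{sa}^m\to\mathbb{R}$ such that, for every $R>0$, $$\limsup_{N\to\infty}\sup_{\|x\|_\infty\le R}|V_N(x)-f(x)|=0\quad\text{and}\quad\limsup_{N\to\infty}\sup_{\|x\|_\infty\le R}\|DV_N(x)-Df(x)\|_2=0,$$ where $DV_N=N\nabla V_N$ is the normalized gradient, i.e. the gradient of $V_N$ for the inner product $\langle\cdot,\cdot\rangle_2$. -/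

import Mathlib

open scoped TensorProduct ENNReal InnerProductSpace Matrix.Norms.L2Operator

noncomputable section

namespace FreeGibbs

/-! ### Non-commutative polynomials and trace polynomials -/

/-- Non-commutative polynomials `ℂ⟨X_1, …, X_m⟩`. -/
abbrev NCP (m : ℕ) : Type := FreeAlgebra ℂ (Fin m)

/-- The linear span of the commutators `pq - qp`. -/
def commutatorSpan (m : ℕ) : Submodule ℂ (NCP m) :=
  Submodule.span ℂ {r | ∃ p q : NCP m, r = p * q - q * p}

/-- Non-commutative polynomials modulo commutators. -/
abbrev CycNCP (m : ℕ) : Type := NCP m ⧸ commutatorSpan m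

/-- Scalar-valued trace polynomials: the symmetric algebra over `NCP / span {pq - qp}`. -/
abbrev TrP0 (m : ℕ) : Type := SymmetricAlgebra ℂ (CycNCP m)

/-- Operator-valued trace polynomials. -/
abbrev TrP1 (m : ℕ) : Type := TrP0 m ⊗[ℂ] NCP m

/-- The formal trace `τ(p)` of a non-commutative polynomial `p`. -/
def formalTrace {m : ℕ} (p : NCP m) : TrP0 m :=
  SymmetricAlgebra.ι ℂ (CycNCP m) ((commutatorSpan m).mkQ p)

/-- The monomial `X_{i_1} ⋯ X_{i_n}` of a word `i_1 … i_n`. -/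
def monomial {m : ℕ} (w : List (Fin m)) : NCP m := (w.map (FreeAlgebra.ι ℂ)).prod

/-- The cyclic derivative of a monomial:
`∑_{k : i_k = j} X_{i_{k+1}} ⋯ X_{i_n} X_{i_1} ⋯ X_{i_{k-1}}`. -/
def cyclicDerivWord {m : ℕ} (j : Fin m) (w : List (Fin m)) : NCP m :=
  ∑ k : Fin w.length,
    if w.get k = j then monomial (w.drop (k + 1) ++ w.take k) else 0

/-- The cyclic derivative `𝒟°_j`, extended linearly from monomials. -/
def cyclicDeriv {m : ℕ} (j : Fin m) : NCP m →ₗ[ℂ] NCP m :=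
  (FreeAlgebra.basisFreeMonoid ℂ (Fin m)).constr ℂ
    fun w : FreeMonoid (Fin m) => cyclicDerivWord j w.toList

lemma basis_eq_monomial {m : ℕ} (w : FreeMonoid (Fin m)) :
    FreeAlgebra.basisFreeMonoid ℂ (Fin m) w = monomial w.toList := by
  simp [FreeAlgebra.basisFreeMonoid, monomial, FreeAlgebra.equivMonoidAlgebraFreeMonoid,
    FreeMonoid.lift_apply]

lemma cyclicDeriv_monomial {m : ℕ} (j : Fin m) (w : List (Fin m)) :
    cyclicDeriv j (monomial w) = cyclicDerivWord j w := by
  have h := basis_eq_monomial (FreeMonoid.ofList w)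
  rw [FreeMonoid.toList_ofList] at h
  rw [← h, cyclicDeriv, Module.Basis.constr_basis, FreeMonoid.toList_ofList]

lemma monomial_append {m : ℕ} (u v : List (Fin m)) :
    monomial (u ++ v) = monomial u * monomial v := by
  simp [monomial]

lemma cyclicDerivWord_append {m : ℕ} (j : Fin m) (u v : List (Fin m)) :
    cyclicDerivWord j (u ++ v) =
      (∑ k : Fin u.length, if u.get k = j then
        monomial (u.drop (k + 1) ++ v ++ u.take k) else 0) +
      ∑ k : Fin v.length, if v.get k = j then
        monomial (v.drop (k + 1) ++ u ++ v.take k) else 0 := by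
  have e : (u ++ v).length = u.length + v.length := List.length_append
  unfold cyclicDerivWord
  rw [← (finCongr e.symm).sum_comp, Fin.sum_univ_add]
  congr 1
  · refine Finset.sum_congr rfl fun k _ => ?_
    have hk : (k : ℕ) < u.length := k.2
    have h1 : (k : ℕ) + 1 - u.length = 0 := by omega
    have h2 : (k : ℕ) - u.length = 0 := by omega
    simp [List.getElem_append_left, List.drop_append, List.take_append, h1, h2]
  · refine Finset.sum_congr rfl fun k _ => ?_
    have h1 : u.length + (k : ℕ) + 1 - u.length = k + 1 := by omega
    have h2 : u.drop (u.length + k + 1) = [] := List.drop_eq_nil_of_le (by omega)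
    have h3 : u.take (u.length + k) = u := List.take_of_length_le (by omega)
    simp [List.drop_append, List.take_append, h1, h2, h3]

lemma span_monomial (m : ℕ) : Submodule.span ℂ (Set.range (monomial (m := m))) = ⊤ := by
  rw [← (FreeAlgebra.basisFreeMonoid ℂ (Fin m)).span_eq]
  congr 1
  ext p
  constructor
  · rintro ⟨w, rfl⟩; exact ⟨FreeMonoid.ofList w, basis_eq_monomial _⟩
  · rintro ⟨w, rfl⟩; exact ⟨w.toList, (basis_eq_monomial _).symm⟩

lemma cyclicDeriv_comm {m : ℕ} (j : Fin m) (p q : NCP m) :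
    cyclicDeriv j (p * q) = cyclicDeriv j (q * p) := by
  have hp : p ∈ Submodule.span ℂ (Set.range (monomial (m := m))) := by
    rw [span_monomial]; trivial
  have hq : q ∈ Submodule.span ℂ (Set.range (monomial (m := m))) := by
    rw [span_monomial]; trivial
  induction hp using Submodule.span_induction with
  | mem p hp =>
    obtain ⟨u, rfl⟩ := hp
    induction hq using Submodule.span_induction with
    | mem q hq =>
      obtain ⟨v, rfl⟩ := hq
      rw [← monomial_append, ← monomial_append, cyclicDeriv_monomial, cyclicDeriv_monomial,
        cyclicDerivWord_append, cyclicDerivWord_append, add_comm]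
    | zero => simp
    | add a b _ _ ha hb => simp only [mul_add, add_mul, map_add, ha, hb]
    | smul c a _ ha => simp only [mul_smul_comm, smul_mul_assoc, map_smul, ha]
  | zero => simp
  | add a b _ _ ha hb => simp only [mul_add, add_mul, map_add, ha, hb]
  | smul c a _ ha => simp only [mul_smul_comm, smul_mul_assoc, map_smul, ha]

/-- A linear map on non-commutative polynomials that does not see commutators, on the quotient. -/
def liftTracial {m : ℕ} {M : Type*} [AddCommGroup M] [Module ℂ M] (φ : NCP m →ₗ[ℂ] M)
    (h : ∀ p q, φ (p * q) = φ (q * p)) : CycNCP m →ₗ[ℂ] M :=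
  (commutatorSpan m).liftQ φ <| by
    rw [commutatorSpan, Submodule.span_le]
    rintro _ ⟨p, q, rfl⟩
    simp [h p q]

/-- The algebra homomorphism `f ↦ f + ε D_j f` into the trivial square-zero extension. -/
def gradHom {m : ℕ} (j : Fin m) : TrP0 m →ₐ[ℂ] TrivSqZeroExt (TrP0 m) (TrP1 m) :=
  SymmetricAlgebra.lift
    ((TrivSqZeroExt.inlAlgHom ℂ (TrP0 m) (TrP1 m)).toLinearMap ∘ₗ SymmetricAlgebra.ι ℂ (CycNCP m) +
      (TrivSqZeroExt.inrHom (TrP0 m) (TrP1 m)).restrictScalars ℂ ∘ₗ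
        liftTracial (TensorProduct.mk ℂ (TrP0 m) (NCP m) 1 ∘ₗ cyclicDeriv j)
          (fun p q => by simp [cyclicDeriv_comm j p q]))

lemma fst_gradHom {m : ℕ} (j : Fin m) (f : TrP0 m) : (gradHom j f).fst = f := by
  have : (TrivSqZeroExt.fstHom ℂ (TrP0 m) (TrP1 m)).comp (gradHom j) = AlgHom.id ℂ _ := by
    apply SymmetricAlgebra.algHom_ext
    ext x
    simp [gradHom]
  exact congr($this f)

/-- The `j`-th gradient operator `D_j : TrP^0 → TrP^1`: the derivation with
`D_j τ(p) = 𝒟°_j p`. -/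
def gradOp {m : ℕ} (j : Fin m) : Derivation ℂ (TrP0 m) (TrP1 m) :=
  Derivation.mk'
    ((TrivSqZeroExt.sndHom (TrP0 m) (TrP1 m)).restrictScalars ℂ ∘ₗ (gradHom j).toLinearMap)
    (fun a b => by simp [fst_gradHom])

theorem gradOp_formalTrace {m : ℕ} (j : Fin m) (p : NCP m) :
    gradOp j (formalTrace p) = 1 ⊗ₜ[ℂ] cyclicDeriv j p := by
  simp [gradOp, gradHom, formalTrace, liftTracial]

section Evaluation

variable {m : ℕ} {A : Type*} [Ring A] [Algebra ℂ A]

/-- Evaluation of a scalar-valued trace polynomial at a tuple `x` in an algebra `A` with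
tracial functional `τ`: the formal symbols `X_j` and `τ` are replaced by `x_j` and `τ`. -/
def eval0 (τ : A →ₗ[ℂ] ℂ) (hτ : ∀ a b, τ (a * b) = τ (b * a)) (x : Fin m → A) :
    TrP0 m →ₐ[ℂ] ℂ :=
  SymmetricAlgebra.lift (liftTracial (τ ∘ₗ (FreeAlgebra.lift ℂ x).toLinearMap)
    (fun p q => by simp [hτ]))

/-- Evaluation of an operator-valued trace polynomial. -/
def eval1 (τ : A →ₗ[ℂ] ℂ) (hτ : ∀ a b, τ (a * b) = τ (b * a)) (x : Fin m → A) :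
    TrP1 m →ₐ[ℂ] A :=
  Algebra.TensorProduct.lift ((Algebra.ofId ℂ A).comp (eval0 τ hτ x)) (FreeAlgebra.lift ℂ x)
    (fun _ _ => Algebra.commutes _ _)

theorem eval0_formalTrace (τ : A →ₗ[ℂ] ℂ) (hτ : ∀ a b, τ (a * b) = τ (b * a)) (x : Fin m → A)
    (p : NCP m) : eval0 τ hτ x (formalTrace p) = τ (FreeAlgebra.lift ℂ x p) := by
  simp [eval0, formalTrace, liftTracial]

theorem eval1_tmul (τ : A →ₗ[ℂ] ℂ) (hτ : ∀ a b, τ (a * b) = τ (b * a)) (x : Fin m → A)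
    (f : TrP0 m) (p : NCP m) :
    eval1 τ hτ x (f ⊗ₜ p) = eval0 τ hτ x f • FreeAlgebra.lift ℂ x p := by
  rw [eval1, Algebra.smul_def]
  exact Algebra.TensorProduct.lift_tmul _ _ _ _ _

end Evaluation

/-! ### The hyperfinite II₁ factor and its ultrapower -/

section GroupVonNeumannAlgebra

variable (G : Type*) [Group G]

/-- The Hilbert space `ℓ²(G)`. -/
abbrev EllTwo : Type _ := lp (fun _ : G => ℂ) 2

variable {G}

/-- The unitary of `ℓ²(G)` induced by a permutation of `G`. -/
def permUnitary (e : Equiv.Perm G) : EllTwo G →ₗᵢ[ℂ] EllTwo G where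
  toFun ξ := ⟨fun g => ξ (e.symm g), by
    have h := lp.memℓp ξ
    rw [memℓp_gen_iff (by norm_num)] at h
    exact memℓp_gen (e.symm.summable_iff.2 h)⟩
  map_add' _ _ := rfl
  map_smul' _ _ := rfl
  norm_map' ξ := by
    rw [lp.norm_eq_tsum_rpow (by norm_num), lp.norm_eq_tsum_rpow (by norm_num)]
    congr 1
    exact e.symm.tsum_eq (fun g => ‖ξ g‖ ^ (2 : ℝ≥0∞).toReal)

/-- Left translation `(λ_g ξ)(h) = ξ(g⁻¹ h)`. -/
def leftTranslation (g : G) : EllTwo G →L[ℂ] EllTwo G :=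
  (permUnitary (Equiv.mulLeft g)).toContinuousLinearMap

/-- Right translation `(ρ_g ξ)(h) = ξ(h g)`. -/
def rightTranslation (g : G) : EllTwo G →L[ℂ] EllTwo G :=
  (permUnitary (Equiv.mulRight g⁻¹)).toContinuousLinearMap

theorem leftTranslation_apply (g h : G) (ξ : EllTwo G) :
    (leftTranslation g ξ : EllTwo G) h = ξ (g⁻¹ * h) := rfl

theorem rightTranslation_apply (g h : G) (ξ : EllTwo G) :
    (rightTranslation g ξ : EllTwo G) h = ξ (h * g) := by
  change ξ ((Equiv.mulRight g⁻¹).symm h) = _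
  simp

lemma star_leftTranslation (g : G) : star (leftTranslation g) = leftTranslation g⁻¹ := by
  rw [ContinuousLinearMap.star_eq_adjoint, eq_comm, ContinuousLinearMap.eq_adjoint_iff]
  intro ξ η
  rw [lp.inner_eq_tsum, lp.inner_eq_tsum, ← (Equiv.mulLeft g).tsum_eq
    (fun h => ⟪ξ h, (leftTranslation g η : EllTwo G) h⟫_ℂ)]
  simp [leftTranslation_apply]

variable (G)

/-- The group von Neumann algebra `L(G)`: the double commutant of the left translations. -/
def groupVN : VonNeumannAlgebra (EllTwo G) where
  toStarSubalgebra := StarSubalgebra.centralizer ℂ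
    (Set.centralizer (Set.range (leftTranslation (G := G))))
  centralizer_centralizer' := by
    change Set.centralizer (Set.centralizer (Set.centralizer _)) = Set.centralizer _
    simp

/-- `L(G)` as a type. -/
abbrev GroupVN : Type _ := ↥(groupVN G).toStarSubalgebra

variable {G} in
/-- The operator on `ℓ²(G)` underlying an element of `L(G)`. -/
abbrev GroupVN.op (T : GroupVN G) : EllTwo G →L[ℂ] EllTwo G := T.1

theorem coe_groupVN : (groupVN G : Set (EllTwo G →L[ℂ] EllTwo G)) =
    Set.centralizer (Set.centralizer (Set.range (leftTranslation (G := G)))) := by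
  have hmem : ∀ T ∈ Set.range (leftTranslation (G := G)),
      star T ∈ Set.range (leftTranslation (G := G)) := by
    rintro _ ⟨g, rfl⟩
    exact ⟨g⁻¹, (star_leftTranslation g).symm⟩
  have h2 : star (Set.centralizer (Set.range (leftTranslation (G := G)))) =
      Set.centralizer (Set.range leftTranslation) := by
    ext T
    exact ⟨fun h => star_star T ▸ Set.star_mem_centralizer' hmem h,
      fun h => Set.star_mem_centralizer' hmem h⟩
  change Set.centralizer (_ ∪ star _) = _
  rw [h2, Set.union_self]

variable {G}

lemma commute_rightTranslation (T : GroupVN G) (g : G) (ξ : EllTwo G) :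
    T.op (rightTranslation g ξ) =
      rightTranslation g (T.op ξ) := by
  have hT : T.op ∈
      Set.centralizer (Set.centralizer (Set.range (leftTranslation (G := G)))) := by
    rw [← coe_groupVN]; exact T.2
  have hg : rightTranslation g ∈ Set.centralizer (Set.range (leftTranslation (G := G))) := by
    rintro _ ⟨k, rfl⟩
    ext ξ h
    simp only [mul_apply_eq_comp, leftTranslation_apply, rightTranslation_apply,
      mul_assoc]
  exact (congr($(hT _ hg) ξ)).symm

open Classical in
/-- The unit vector `δ_1 ∈ ℓ²(G)`. -/
def deltaOne : EllTwo G := lp.single 2 (1 : G) (1 : ℂ)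

/-- The canonical trace `τ(T) = ⟨δ_1, T δ_1⟩` on `L(G)`. -/
def groupTrace : GroupVN G →ₗ[ℂ] ℂ where
  toFun T := ⟪deltaOne, T.op deltaOne⟫_ℂ
  map_add' S T := by simp
  map_smul' c T := by simp

lemma inner_deltaOne (ξ : EllTwo G) : ⟪deltaOne, ξ⟫_ℂ = ξ 1 := by
  classical
  rw [deltaOne]
  convert lp.inner_single_left (𝕜 := ℂ) (G := fun _ : G => ℂ) 1 (1 : ℂ) ξ using 1
  simp

lemma star_apply_deltaOne (T : GroupVN G) (g : G) :
    (GroupVN.op (star T)) deltaOne g =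
      star (T.op deltaOne g⁻¹) := by
  have key : ∀ (S : GroupVN G) (h : G), S.op deltaOne h =
      ⟪deltaOne, S.op (rightTranslation h deltaOne)⟫_ℂ := by
    intro S h
    rw [commute_rightTranslation, inner_deltaOne, rightTranslation_apply, one_mul]
  have hinv : ∀ (h : G) (ξ η : EllTwo G), ⟪rightTranslation h ξ, rightTranslation h η⟫_ℂ =
      ⟪ξ, η⟫_ℂ := fun h ξ η => (permUnitary (Equiv.mulRight h⁻¹)).inner_map_map ξ η
  have hcomp : ∀ ξ : EllTwo G, rightTranslation g⁻¹ (rightTranslation g ξ) = ξ := by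
    intro ξ
    ext h
    simp [rightTranslation_apply]
  rw [key, key]
  rw [show (GroupVN.op (star T)) =
    ContinuousLinearMap.adjoint T.op from rfl,
    ContinuousLinearMap.adjoint_inner_right, ← hinv g⁻¹, hcomp, ← commute_rightTranslation,
    ← inner_conj_symm]
  rfl

lemma groupTrace_mul (a b : GroupVN G) : groupTrace (a * b) =
    ∑' g, a.op deltaOne g⁻¹ *
      b.op deltaOne g := by
  have : groupTrace (a * b) = ⟪(GroupVN.op (star a)) deltaOne,
      b.op deltaOne⟫_ℂ := by
    rw [show (GroupVN.op (star a)) =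
      ContinuousLinearMap.adjoint a.op from rfl,
      ContinuousLinearMap.adjoint_inner_left]
    rfl
  rw [this, lp.inner_eq_tsum]
  refine tsum_congr fun g => ?_
  rw [star_apply_deltaOne]
  simp [mul_comm]

theorem groupTrace_comm (a b : GroupVN G) : groupTrace (a * b) = groupTrace (b * a) := by
  rw [groupTrace_mul, groupTrace_mul, ← (Equiv.inv G).tsum_eq]
  simp [mul_comm]

/-- The norm `‖T‖₂ = τ(T* T)^{1/2}` on `L(G)`. -/
def groupNorm2 (T : GroupVN G) : ℝ := √(groupTrace (star T * T)).re

lemma groupNorm2_eq (T : GroupVN G) :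
    groupNorm2 T = ‖T.op deltaOne‖ := by
  have : groupTrace (star T * T) = ⟪T.op deltaOne,
      T.op deltaOne⟫_ℂ := by
    rw [← ContinuousLinearMap.adjoint_inner_right]
    rfl
  rw [groupNorm2, this, inner_self_eq_norm_sq_to_K]
  norm_cast
  exact Real.sqrt_sq (norm_nonneg _)

lemma groupNorm2_star (T : GroupVN G) : groupNorm2 (star T) = groupNorm2 T := by
  rw [groupNorm2, groupNorm2, star_star, groupTrace_comm]

lemma groupNorm2_add_le (S T : GroupVN G) : groupNorm2 (S + T) ≤ groupNorm2 S + groupNorm2 T := by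
  rw [groupNorm2_eq, groupNorm2_eq, groupNorm2_eq]
  exact norm_add_le (S.op deltaOne) (T.op deltaOne)

lemma groupNorm2_mul_le (S T : GroupVN G) : groupNorm2 (S * T) ≤ ‖S‖ * groupNorm2 T := by
  rw [groupNorm2_eq, groupNorm2_eq]
  have h : (S * T).op = S.op * T.op := rfl
  have h2 : ‖S‖ = ‖S.op‖ := rfl
  rw [h, h2]
  exact ContinuousLinearMap.le_opNorm S.op _

lemma groupNorm2_mul_le' (S T : GroupVN G) : groupNorm2 (S * T) ≤ groupNorm2 S * ‖T‖ := by
  have h := groupNorm2_mul_le (star T) (star S)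
  have h2 : ‖star T‖ = ‖T‖ := norm_star T.op
  rwa [← star_mul, groupNorm2_star, groupNorm2_star, h2, mul_comm] at h

lemma norm_deltaOne : ‖(deltaOne : EllTwo G)‖ = 1 := by
  classical
  rw [deltaOne, lp.norm_single (by norm_num)]; simp

lemma norm_groupTrace_le_two (T : GroupVN G) : ‖groupTrace T‖ ≤ groupNorm2 T := by
  rw [groupNorm2_eq]
  refine (norm_inner_le_norm (𝕜 := ℂ) deltaOne
    (T.op deltaOne)).trans_eq ?_
  rw [norm_deltaOne, one_mul]

lemma groupNorm2_le_norm (T : GroupVN G) : groupNorm2 T ≤ ‖T‖ := by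
  rw [groupNorm2_eq]
  simpa [norm_deltaOne] using
    ContinuousLinearMap.le_opNorm T.op deltaOne

end GroupVonNeumannAlgebra

/-- The group of permutations of `ℕ` that move only finitely many points. -/
def finitePerm : Subgroup (Equiv.Perm ℕ) where
  carrier := {σ | {n | σ n ≠ n}.Finite}
  one_mem' := by simp
  mul_mem' {σ π} hσ hπ := (hσ.union hπ).subset fun n hn => by
    by_contra h
    simp only [Set.mem_union, Set.mem_ofPred_eq, not_or, not_not] at h
    exact hn (by rw [Equiv.Perm.mul_apply, h.2, h.1])
  inv_mem' {σ} hσ := hσ.subset fun n hn h => hn (by rw [Equiv.Perm.inv_eq_iff_eq, h])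

/-- The hyperfinite II₁ factor `ℛ`, in Murray and von Neumann's realization as the group
von Neumann algebra of the group of finitely supported permutations of `ℕ` (a locally finite
group with infinite conjugacy classes). -/
def HyperfiniteR : Type := GroupVN finitePerm

namespace HyperfiniteR

instance : NormedRing HyperfiniteR := inferInstanceAs (NormedRing (GroupVN finitePerm))

instance : NormedAlgebra ℂ HyperfiniteR := inferInstanceAs (NormedAlgebra ℂ (GroupVN finitePerm))

instance : StarRing HyperfiniteR := inferInstanceAs (StarRing (GroupVN finitePerm))

instance : StarModule ℂ HyperfiniteR := inferInstanceAs (StarModule ℂ (GroupVN finitePerm))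

/-- The trace of `ℛ`. -/
def trace : HyperfiniteR →ₗ[ℂ] ℂ := groupTrace (G := finitePerm)

/-- The norm `‖a‖₂ = τ(a* a)^{1/2}` on `ℛ`. -/
def norm2 (a : HyperfiniteR) : ℝ := √(trace (star a * a)).re

theorem trace_comm (a b : HyperfiniteR) : trace (a * b) = trace (b * a) := groupTrace_comm a b

lemma norm_star (a : HyperfiniteR) : ‖star a‖ = ‖a‖ :=
  _root_.norm_star (Subtype.val a : EllTwo finitePerm →L[ℂ] EllTwo finitePerm)

lemma norm2_nonneg (a : HyperfiniteR) : 0 ≤ norm2 a := Real.sqrt_nonneg _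

lemma norm2_zero : norm2 0 = 0 := by simp [norm2]

lemma norm2_star (a : HyperfiniteR) : norm2 (star a) = norm2 a := groupNorm2_star a

lemma norm2_add_le (a b : HyperfiniteR) : norm2 (a + b) ≤ norm2 a + norm2 b :=
  groupNorm2_add_le a b

lemma norm2_mul_le (a b : HyperfiniteR) : norm2 (a * b) ≤ ‖a‖ * norm2 b := groupNorm2_mul_le a b

lemma norm2_mul_le' (a b : HyperfiniteR) : norm2 (a * b) ≤ norm2 a * ‖b‖ :=
  groupNorm2_mul_le' a b

lemma norm_trace_le_norm2 (a : HyperfiniteR) : ‖trace a‖ ≤ norm2 a := norm_groupTrace_le_two a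

lemma norm2_le_norm (a : HyperfiniteR) : norm2 a ≤ ‖a‖ := groupNorm2_le_norm a

end HyperfiniteR

section Ultrapower

open HyperfiniteR

/-- Operator-norm bounded sequences in `ℛ`. -/
def boundedSeq : StarSubalgebra ℂ (ℕ → HyperfiniteR) where
  carrier := {x | ∃ C : ℝ, ∀ n, ‖x n‖ ≤ C}
  mul_mem' := by
    rintro x y ⟨C, hC⟩ ⟨D, hD⟩
    exact ⟨C * D, fun n => (norm_mul_le (x n) (y n)).trans
      (mul_le_mul (hC n) (hD n) (norm_nonneg _) ((norm_nonneg _).trans (hC n)))⟩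
  add_mem' := by
    rintro x y ⟨C, hC⟩ ⟨D, hD⟩
    exact ⟨C + D, fun n => (norm_add_le (x n) (y n)).trans (add_le_add (hC n) (hD n))⟩
  algebraMap_mem' c := ⟨‖(algebraMap ℂ HyperfiniteR c)‖, fun _ => le_rfl⟩
  star_mem' := by
    rintro x ⟨C, hC⟩
    exact ⟨C, fun n => (HyperfiniteR.norm_star (x n)).trans_le (hC n)⟩

variable (ω : Ultrafilter ℕ)

/-- The ideal of bounded sequences with `lim_{n → ω} ‖x_n‖₂ = 0`. -/
def nullIdeal : Ideal boundedSeq where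
  carrier := {x | Filter.Tendsto (fun n => norm2 (x.1 n)) ω (nhds 0)}
  add_mem' {x y} hx hy := by
    refine squeeze_zero (fun n => norm2_nonneg _) (fun n => norm2_add_le _ _) ?_
    simpa using hx.add hy
  zero_mem' := by
    refine tendsto_const_nhds.congr fun n => ?_
    exact norm2_zero.symm
  smul_mem' x y hy := by
    obtain ⟨C, hC⟩ := x.2
    refine squeeze_zero (fun n => norm2_nonneg _) (fun n => (norm2_mul_le _ _).trans
      (mul_le_mul_of_nonneg_right (hC n) (norm2_nonneg _))) ?_
    simpa using hy.const_mul C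

instance : (nullIdeal ω).IsTwoSided where
  mul_mem_of_left {x} y hx := by
    obtain ⟨C, hC⟩ := y.2
    refine squeeze_zero (fun n => norm2_nonneg _) (fun n => (norm2_mul_le' _ _).trans
      (mul_le_mul_of_nonneg_left (hC n) (norm2_nonneg _))) ?_
    simpa using Filter.Tendsto.mul_const C hx

/-- The tracial ultrapower `ℛ^ω`. -/
def UltraR : Type := boundedSeq ⧸ nullIdeal ω

instance : Ring (UltraR ω) := inferInstanceAs (Ring (boundedSeq ⧸ nullIdeal ω))

instance : Algebra ℂ (UltraR ω) := inferInstanceAs (Algebra ℂ (boundedSeq ⧸ nullIdeal ω))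

/-- The class `[x_n] ∈ ℛ^ω` of a bounded sequence. -/
def UltraR.mk : boundedSeq →ₐ[ℂ] UltraR ω := Ideal.Quotient.mkₐ ℂ (nullIdeal ω)

variable {ω}

lemma UltraR.mk_surjective : Function.Surjective (UltraR.mk ω) := Ideal.Quotient.mk_surjective

lemma UltraR.mk_eq_mk {x y : boundedSeq} :
    UltraR.mk ω x = UltraR.mk ω y ↔ x - y ∈ nullIdeal ω := Ideal.Quotient.eq

lemma star_mem_nullIdeal {x : boundedSeq} (hx : x ∈ nullIdeal ω) : star x ∈ nullIdeal ω :=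
  Filter.Tendsto.congr (fun n => (norm2_star (x.1 n)).symm) hx

/-- The termwise adjoint on `ℛ^ω`. -/
def ultraStar : UltraR ω → UltraR ω :=
  Quotient.lift (fun x => UltraR.mk ω (star x)) fun x y h => by
    have h : x - y ∈ nullIdeal ω := (Submodule.quotientRel_def _).1 h
    rw [UltraR.mk_eq_mk, ← star_sub (R := boundedSeq)]
    exact star_mem_nullIdeal h

lemma ultraStar_mk (x : boundedSeq) : ultraStar (UltraR.mk ω x) = UltraR.mk ω (star x) := rfl

lemma ultraStar_involutive (a : UltraR ω) : ultraStar (ultraStar a) = a := by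
  obtain ⟨x, rfl⟩ := UltraR.mk_surjective a
  exact congrArg (UltraR.mk ω) (star_star x)

lemma ultraStar_add (a b : UltraR ω) : ultraStar (a + b) = ultraStar a + ultraStar b := by
  obtain ⟨x, rfl⟩ := UltraR.mk_surjective a
  obtain ⟨y, rfl⟩ := UltraR.mk_surjective b
  exact (congrArg ultraStar (map_add (UltraR.mk ω) x y).symm).trans
    ((congrArg (UltraR.mk ω) (star_add x y)).trans (map_add (UltraR.mk ω) _ _))

lemma ultraStar_mul (a b : UltraR ω) : ultraStar (a * b) = ultraStar b * ultraStar a := by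
  obtain ⟨x, rfl⟩ := UltraR.mk_surjective a
  obtain ⟨y, rfl⟩ := UltraR.mk_surjective b
  exact (congrArg ultraStar (map_mul (UltraR.mk ω) x y).symm).trans
    ((congrArg (UltraR.mk ω) (star_mul x y)).trans (map_mul (UltraR.mk ω) _ _))

instance : Star (UltraR ω) := ⟨ultraStar⟩

instance : StarRing (UltraR ω) where
  star_involutive := ultraStar_involutive
  star_mul := ultraStar_mul
  star_add := ultraStar_add

theorem UltraR.star_mk (x : boundedSeq) : star (UltraR.mk ω x) = UltraR.mk ω (star x) := rfl

instance : StarModule ℂ (UltraR ω) where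
  star_smul c a := by
    obtain ⟨x, rfl⟩ := UltraR.mk_surjective a
    exact (congrArg star (map_smul (UltraR.mk ω) c x).symm).trans
      ((congrArg (UltraR.mk ω) (star_smul c x)).trans (map_smul (UltraR.mk ω) _ _))

lemma exists_tendsto_trace (ω : Ultrafilter ℕ) (x : boundedSeq) :
    ∃ z : ℂ, Filter.Tendsto (fun n => trace (x.1 n)) ω (nhds z) := by
  obtain ⟨C, hC⟩ := x.2
  obtain ⟨z, -, hz⟩ := (isCompact_closedBall (0 : ℂ) C).ultrafilter_le_nhds
    (ω.map fun n => trace (x.1 n)) (by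
      rw [Filter.le_principal_iff]
      refine Filter.mem_map.2 (Filter.Eventually.of_forall fun n => ?_)
      refine mem_closedBall_zero_iff.2 ?_
      exact (norm_trace_le_norm2 _).trans ((norm2_le_norm _).trans (hC n)))
  exact ⟨z, hz⟩

/-- `lim_{n → ω} τ(x_n)` for a bounded sequence `x`. -/
def ultraLimTrace (ω : Ultrafilter ℕ) (x : boundedSeq) : ℂ := (exists_tendsto_trace ω x).choose

lemma tendsto_ultraLimTrace (ω : Ultrafilter ℕ) (x : boundedSeq) :
    Filter.Tendsto (fun n => trace (x.1 n)) ω (nhds (ultraLimTrace ω x)) :=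
  (exists_tendsto_trace ω x).choose_spec

/-- The trace `τ_ω([x_n]) = lim_{n → ω} τ(x_n)` on `ℛ^ω`, as a function. -/
def ultraTraceFun (ω : Ultrafilter ℕ) : UltraR ω → ℂ :=
  Quotient.lift (ultraLimTrace ω) fun x y h => by
    have h : x - y ∈ nullIdeal ω := (Submodule.quotientRel_def _).1 h
    have h0 : Filter.Tendsto (fun n => trace ((x - y).1 n)) ω (nhds 0) :=
      squeeze_zero_norm (fun n => norm_trace_le_norm2 _) h
    have h1 := (tendsto_ultraLimTrace ω x).sub (tendsto_ultraLimTrace ω y)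
    refine sub_eq_zero.1 (tendsto_nhds_unique h1 (h0.congr fun n => ?_))
    exact map_sub trace _ _

theorem tendsto_ultraTraceFun (ω : Ultrafilter ℕ) (x : boundedSeq) :
    Filter.Tendsto (fun n => trace (x.1 n)) ω (nhds (ultraTraceFun ω (UltraR.mk ω x))) :=
  tendsto_ultraLimTrace ω x

/-- The trace `τ_ω([x_n]) = lim_{n → ω} τ(x_n)` on `ℛ^ω`. -/
def ultraTrace (ω : Ultrafilter ℕ) : UltraR ω →ₗ[ℂ] ℂ where
  toFun := ultraTraceFun ω
  map_add' a b := by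
    obtain ⟨x, rfl⟩ := UltraR.mk_surjective a
    obtain ⟨y, rfl⟩ := UltraR.mk_surjective b
    rw [← map_add]
    refine tendsto_nhds_unique (tendsto_ultraTraceFun ω (x + y))
      (((tendsto_ultraTraceFun ω x).add (tendsto_ultraTraceFun ω y)).congr fun n => ?_)
    exact (map_add trace _ _).symm
  map_smul' c a := by
    obtain ⟨x, rfl⟩ := UltraR.mk_surjective a
    rw [← map_smul]
    refine tendsto_nhds_unique (tendsto_ultraTraceFun ω (c • x))
      (((tendsto_ultraTraceFun ω x).const_mul c).congr fun n => ?_)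
    exact (map_smul trace c _).symm

theorem ultraTrace_comm (a b : UltraR ω) : ultraTrace ω (a * b) = ultraTrace ω (b * a) := by
  obtain ⟨x, rfl⟩ := UltraR.mk_surjective a
  obtain ⟨y, rfl⟩ := UltraR.mk_surjective b
  rw [← map_mul, ← map_mul]
  refine tendsto_nhds_unique (tendsto_ultraTraceFun ω (x * y))
    ((tendsto_ultraTraceFun ω (y * x)).congr fun n => ?_)
  exact trace_comm _ _

end Ultrapower

/-! ### Matrices and the space `𝒯^{0,1}` -/

/-- `M_N(ℂ)`, for `N ≥ 1`; with the operator norm. -/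
abbrev Mat (N : ℕ+) : Type := Matrix (Fin N) (Fin N) ℂ

/-- `M_N(ℂ)_sa^m`; its norm is `‖x‖_∞ = max_j ‖x_j‖`. -/
abbrev SaMat (m : ℕ) (N : ℕ+) : Type := Fin m → selfAdjoint (Mat N)

/-- The normalized trace `τ_N = (1/N) Tr`. -/
def tauN (N : ℕ+) : Mat N →ₗ[ℂ] ℂ := ((N : ℕ) : ℂ)⁻¹ • Matrix.traceLinearMap (Fin N) ℂ ℂ

lemma tauN_comm (N : ℕ+) (a b : Mat N) : tauN N (a * b) = tauN N (b * a) := by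
  simp [tauN, Matrix.trace_mul_comm a b]

/-- The inner product `⟨x, y⟩₂ = ∑_j τ_N(x_j y_j)` on `M_N(ℂ)_sa^m`. -/
def inner2 {m : ℕ} {N : ℕ+} (x y : SaMat m N) : ℝ :=
  ∑ j, (tauN N ((x j : Mat N) * (y j : Mat N))).re

/-- The norm `‖y‖₂ = (∑_j τ_N(y_j* y_j))^{1/2}` on `M_N(ℂ)^m`. -/
def norm2 {m : ℕ} {N : ℕ+} (y : Fin m → Mat N) : ℝ :=
  √(∑ j, (tauN N (star (y j) * y j)).re)

lemma norm2_eq {m : ℕ} {N : ℕ+} (y : Fin m → Mat N) : norm2 y =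
    √((N : ℕ) : ℝ)⁻¹ * ‖WithLp.toLp 2 (fun i : Fin m × Fin N × Fin N => y i.1 i.2.1 i.2.2)‖ := by
  rw [EuclideanSpace.norm_eq, ← Real.sqrt_mul (by positivity), norm2]
  congr 1
  rw [Fintype.sum_prod_type, Finset.mul_sum]
  refine Finset.sum_congr rfl fun j _ => ?_
  rw [Fintype.sum_prod_type, Finset.sum_comm]
  have h : ∀ a b : Fin N, ((starRingEnd ℂ) (y j a b) * y j a b).re = ‖y j a b‖ ^ 2 := fun a b => by
    rw [mul_comm, Complex.mul_conj, Complex.ofReal_re, Complex.normSq_eq_norm_sq]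
  simp only [tauN, LinearMap.smul_apply, Matrix.traceLinearMap_apply, Matrix.trace, Matrix.diag,
    Matrix.mul_apply, Matrix.star_apply, smul_eq_mul]
  rw [show (((N : ℕ) : ℂ))⁻¹ = ((((N : ℕ) : ℝ)⁻¹ : ℝ) : ℂ) by push_cast; rfl,
    Complex.re_ofReal_mul, Complex.re_sum]
  simp only [Complex.re_sum]
  congr 1
  exact Finset.sum_congr rfl fun a _ => Finset.sum_congr rfl fun b _ => h b a

lemma norm2_add_le {m : ℕ} {N : ℕ+} (y z : Fin m → Mat N) : norm2 (y + z) ≤ norm2 y + norm2 z := by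
  rw [norm2_eq, norm2_eq, norm2_eq, ← mul_add]
  refine mul_le_mul_of_nonneg_left ?_ (Real.sqrt_nonneg _)
  exact norm_add_le
    (WithLp.toLp 2 (fun i : Fin m × Fin N × Fin N => y i.1 i.2.1 i.2.2))
    (WithLp.toLp 2 (fun i : Fin m × Fin N × Fin N => z i.1 i.2.1 i.2.2))

lemma norm2_neg {m : ℕ} {N : ℕ+} (y : Fin m → Mat N) : norm2 (-y) = norm2 y := by
  simp [norm2]

lemma norm2_zero {m : ℕ} {N : ℕ+} : norm2 (0 : Fin m → Mat N) = 0 := by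
  simp [norm2]

/-- `limsup_{N → ∞} sup_{‖x‖_∞ ≤ R} h_N(x)`. -/
def ballLimsup {m : ℕ} (R : ℝ) (h : ∀ N : ℕ+, SaMat m N → ℝ≥0∞) : ℝ≥0∞ :=
  Filter.limsup (fun N : ℕ+ => ⨆ (x : SaMat m N) (_ : ‖x‖ ≤ R), h N x) Filter.atTop

lemma ballLimsup_le_add {m : ℕ} (R : ℝ) (h h₁ h₂ : ∀ N : ℕ+, SaMat m N → ℝ≥0∞)
    (H : ∀ N x, h N x ≤ h₁ N x + h₂ N x) :
    ballLimsup R h ≤ ballLimsup R h₁ + ballLimsup R h₂ := by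
  refine ENNReal.le_of_forall_pos_le_add fun ε hε hfin => ?_
  have hε' : (ε / 2 : ℝ≥0∞) ≠ 0 := by simpa using hε.ne'
  have h1 := Filter.eventually_lt_of_limsup_lt (ENNReal.lt_add_right
    (a := ballLimsup R h₁) (ENNReal.add_lt_top.1 hfin).1.ne hε')
  have h2 := Filter.eventually_lt_of_limsup_lt (ENNReal.lt_add_right
    (a := ballLimsup R h₂) (ENNReal.add_lt_top.1 hfin).2.ne hε')
  refine Filter.limsup_le_of_le (h := ?_)
  filter_upwards [h1, h2] with N hN1 hN2
  refine iSup₂_le fun x hx => (H N x).trans ?_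
  calc h₁ N x + h₂ N x ≤ (ballLimsup R h₁ + ε / 2) + (ballLimsup R h₂ + ε / 2) :=
        add_le_add ((le_iSup₂ (f := fun (x : SaMat m N) (_ : ‖x‖ ≤ R) => h₁ N x) x hx).trans hN1.le)
          ((le_iSup₂ (f := fun (x : SaMat m N) (_ : ‖x‖ ≤ R) => h₂ N x) x hx).trans hN2.le)
    _ = ballLimsup R h₁ + ballLimsup R h₂ + ε := by
        rw [add_add_add_comm, ENNReal.add_halves]

lemma ballLimsup_zero {m : ℕ} (R : ℝ) : ballLimsup R (fun (N : ℕ+) (_ : SaMat m N) => 0) = 0 := by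
  simp [ballLimsup]

namespace TrP

/-- The value `f(x)` of a scalar-valued trace polynomial at `x ∈ M_N(ℂ)_sa^m`. -/
def evalMat {m : ℕ} {N : ℕ+} (f : TrP0 m) (x : SaMat m N) : ℂ :=
  eval0 (tauN N) (tauN_comm N) (fun j => (x j : Mat N)) f

/-- The value `Df(x) = (D_1 f(x), …, D_m f(x)) ∈ M_N(ℂ)^m` at `x ∈ M_N(ℂ)_sa^m`. -/
def gradMat {m : ℕ} {N : ℕ+} (f : TrP0 m) (x : SaMat m N) : Fin m → Mat N :=
  fun j => eval1 (tauN N) (tauN_comm N) (fun j => (x j : Mat N)) (gradOp j f)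

/-- The value `f(x)` of a scalar-valued trace polynomial at `x ∈ (ℛ^ω_sa)^m`. -/
def evalUltra {m : ℕ} {ω : Ultrafilter ℕ} (f : TrP0 m) (x : Fin m → selfAdjoint (UltraR ω)) : ℂ :=
  eval0 (ultraTrace ω) ultraTrace_comm (fun j => (x j : UltraR ω)) f

lemma evalMat_sub {m : ℕ} {N : ℕ+} (f g : TrP0 m) (x : SaMat m N) :
    evalMat (f - g) x = evalMat f x - evalMat g x := map_sub _ _ _

lemma gradMat_sub {m : ℕ} {N : ℕ+} (f g : TrP0 m) (x : SaMat m N) :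
    gradMat (f - g) x = gradMat f x - gradMat g x := by
  ext1 j
  simp only [gradMat, map_sub, Pi.sub_apply]

/-- `‖f - g‖_R` for the seminorm of `𝒯_m^0`. -/
def dist0 {m : ℕ} (R : ℝ) (f g : TrP0 m) : ℝ≥0∞ :=
  ballLimsup R fun N (x : SaMat m N) => ‖evalMat (f - g) x‖ₑ

/-- `‖Df - Dg‖_R` for the seminorm of `(𝒯_m^1)^m`. -/
def dist1 {m : ℕ} (R : ℝ) (f g : TrP0 m) : ℝ≥0∞ :=
  ballLimsup R fun N (x : SaMat m N) => ENNReal.ofReal (norm2 (gradMat f x - gradMat g x))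

lemma dist0_self {m : ℕ} (R : ℝ) (f : TrP0 m) : dist0 R f f = 0 := by
  have h : ∀ (N : ℕ+) (x : SaMat m N), ‖evalMat (f - f) x‖ₑ = 0 := fun N x => by
    rw [evalMat_sub, sub_self, enorm_zero]
  simp only [dist0, h, ballLimsup_zero]

lemma dist1_self {m : ℕ} (R : ℝ) (f : TrP0 m) : dist1 R f f = 0 := by
  simp only [dist1, sub_self, norm2_zero, ENNReal.ofReal_zero, ballLimsup_zero]

lemma dist0_comm {m : ℕ} (R : ℝ) (f g : TrP0 m) : dist0 R f g = dist0 R g f := by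
  simp only [dist0, evalMat_sub, enorm_sub_rev]

lemma dist1_comm {m : ℕ} (R : ℝ) (f g : TrP0 m) : dist1 R f g = dist1 R g f := by
  have h : ∀ (N : ℕ+) (x : SaMat m N),
      norm2 (gradMat f x - gradMat g x) = norm2 (gradMat g x - gradMat f x) := fun N x => by
    rw [← norm2_neg, neg_sub]
  simp only [dist1, h]

lemma dist0_triangle {m : ℕ} (R : ℝ) (f g h : TrP0 m) :
    dist0 R f h ≤ dist0 R f g + dist0 R g h := by
  refine ballLimsup_le_add R _ _ _ fun N x => ?_
  simp only [evalMat_sub]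
  rw [← sub_add_sub_cancel _ (evalMat g x)]
  exact enorm_add_le _ _

lemma dist1_triangle {m : ℕ} (R : ℝ) (f g h : TrP0 m) :
    dist1 R f h ≤ dist1 R f g + dist1 R g h := by
  refine ballLimsup_le_add R _ _ _ fun N x => ?_
  rw [← sub_add_sub_cancel _ (gradMat g x)]
  exact (ENNReal.ofReal_le_ofReal (norm2_add_le _ _)).trans ENNReal.ofReal_add_le

lemma min_one_add_le (a b : ℝ≥0∞) : min 1 (a + b) ≤ min 1 a + min 1 b := by
  rcases le_total 1 a with ha | ha
  · rw [min_eq_left ha]; exact (min_le_left _ _).trans le_self_add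
  · rcases le_total 1 b with hb | hb
    · rw [min_eq_left hb]; exact (min_le_left _ _).trans le_add_self
    · rw [min_eq_right ha, min_eq_right hb]; exact min_le_right _ _

/-- The (pseudo-)metric
`d(f, g) = ∑_{n ≥ 1} 2^{-n} [min(1, ‖f - g‖_n) + min(1, ‖Df - Dg‖_n)]` on trace polynomials. -/
instance (m : ℕ) : PseudoEMetricSpace (TrP0 m) where
  edist f g := ∑' n : ℕ, 2⁻¹ ^ (n + 1) * (min 1 (dist0 (n + 1) f g) + min 1 (dist1 (n + 1) f g))
  edist_self f := by simp [dist0_self, dist1_self]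
  edist_comm f g := by simp only [dist0_comm _ f g, dist1_comm _ f g]
  edist_triangle f g h := by
    rw [← ENNReal.tsum_add]
    refine ENNReal.tsum_le_tsum fun n => ?_
    rw [← mul_add, add_add_add_comm]
    gcongr
    · exact (min_le_min_left _ (dist0_triangle _ f g h)).trans (min_one_add_le _ _)
    · exact (min_le_min_left _ (dist1_triangle _ f g h)).trans (min_one_add_le _ _)

end TrP

/-- The space `𝒯_m^{0,1}`: the completion of the trace polynomials for the metric `d`. -/
def T01 (m : ℕ) : Type := UniformSpace.Completion (TrP0 m)

namespace T01

/-- The restriction `f|_{M_N(ℂ)_sa^m}`: if trace polynomials `f⁽ᵏ⁾` converge to `f`, then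
`f(x) = lim_k f⁽ᵏ⁾(x)`. -/
def evalMat {m : ℕ} (f : T01 m) {N : ℕ+} (x : SaMat m N) : ℂ :=
  UniformSpace.Completion.extension (fun g : TrP0 m => TrP.evalMat g x) f

/-- The restriction `Df|_{M_N(ℂ)_sa^m}`: if trace polynomials `f⁽ᵏ⁾` converge to `f`, then
`Df(x) = lim_k Df⁽ᵏ⁾(x)`. -/
def gradMat {m : ℕ} (f : T01 m) {N : ℕ+} (x : SaMat m N) : Fin m → Mat N :=
  UniformSpace.Completion.extension (fun g : TrP0 m => TrP.gradMat g x) f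

/-- The function on `(ℛ^ω_sa)^m` defined by `f`: if trace polynomials `f⁽ᵏ⁾` converge to `f`,
then `f(x) = lim_k f⁽ᵏ⁾(x)`. -/
def evalUltra {m : ℕ} (f : T01 m) {ω : Ultrafilter ℕ} (x : Fin m → selfAdjoint (UltraR ω)) : ℂ :=
  UniformSpace.Completion.extension (fun g : TrP0 m => TrP.evalUltra g x) f

/-- `f` is real-valued. -/
def IsReal {m : ℕ} (f : T01 m) : Prop :=
  ∀ (N : ℕ+) (x : SaMat m N), (f.evalMat x).im = 0

/-- `[V_•] = f`: `limsup_N sup_{‖x‖_∞ ≤ R} |V_N(x) - f(x)| = 0` for all `R > 0`. -/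
def IsRepresentedBy {m : ℕ} (f : T01 m) (V : ∀ N : ℕ+, SaMat m N → ℝ) : Prop :=
  ∀ R : ℝ, 0 < R → ballLimsup R (fun N x => ‖(V N x : ℂ) - f.evalMat x‖ₑ) = 0

/-- `[W_•] = Df`: `limsup_N sup_{‖x‖_∞ ≤ R} ‖W_N(x) - Df(x)‖₂ = 0` for all `R > 0`. -/
def IsGradRepresentedBy {m : ℕ} (f : T01 m) (W : ∀ N : ℕ+, SaMat m N → SaMat m N) : Prop :=
  ∀ R : ℝ, 0 < R → ballLimsup R
    (fun N x => ENNReal.ofReal (norm2 ((fun j => (W N x j : Mat N)) - f.gradMat x))) = 0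

end T01

/-- `W` is the normalized gradient `DV = N ∇V` of the differentiable function `V`; `∇` is
the gradient for the inner product `∑_j Tr(x_j y_j)`, so `DV` is the gradient for `⟨x, y⟩₂`. -/
def IsNormalizedGradient {m : ℕ} {N : ℕ+} (V : SaMat m N → ℝ) (W : SaMat m N → SaMat m N) : Prop :=
  ∀ x y, fderiv ℝ V x y = inner2 (W x) y

end FreeGibbs

end

open FreeGibbs

noncomputable section

namespace FreeGibbs

open Filter Topology Uniformity
open scoped Kronecker

/-! ### Moments determine the values of trace polynomials -/

section Moments

variable {m : ℕ}

/-! A trace polynomial is a polynomial in the moments of its argument, so its value does not see in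
which tracial algebra the argument lives. Each implication moves tuples between algebras by a linear
map that preserves moments, exactly or in the limit. Linearity carries convex combinations along,
and elements of `T01 m` follow by approximation that is uniform on balls.

The amplification `x ↦ x ⊗ 1_k` preserves moments and does not increase norms. Hence the limsup in
the metric dominates the supremum over a ball at every single size (`TrP.eventually_uniformity`),
which makes the values of `f` and `Df` limits of those of trace polynomials, uniformly in the size
(`T01.eventually_approx`). The same device gives 3 → 1: `f x = f (x ⊗ 1_k)` is close to the value of
the convex function `V_{Nk}` at `x ⊗ 1_k` for large `k`.

1 → 2: the factor `ℛ` is `L(G)` for `G` the finitely supported permutations of `ℕ`. Compressing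
operators to `ℓ²` of the finite subgroup of permutations of `k` points is linear, contractive,
*-preserving, and correct on moments as `k → ∞` (`exists_compression`). Together with the definition
of the trace of `ℛ^ω`, this passes closed conditions on values from matrices to `ℛ^ω`
(`exists_radius_evalUltra_mem`).

2 → 1: it suffices to embed `M_N(ℂ)` into `ℛ^ω` with the right moments (`exists_ultra_embedding`).
For large `K`, `G` contains the wreath product of `ℤ/K` by the permutations of `N` blocks. The
spectral projections of the abelian group `(ℤ/K)^N` are permuted by the block permutations. Grouping
the injective characters by the position of their largest coordinate gives `N` orthogonal equivalent
projections of total trace `K(K-1)⋯(K-N+1)/K^N`. They carry a system of matrix units, and the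
missing trace disappears in the ultrapower as `K → ∞`.

1 → 3: take `V_N` to be the restriction of `f`. On matrices the derivative of a trace polynomial is
given by its cyclic gradient, and locally uniform convergence of the gradients extends this to `f`
(`T01.hasFDerivAt_evalMat`). -/

lemma lift_monomial {A : Type*} [Ring A] [Algebra ℂ A] (x : Fin m → A) (w : List (Fin m)) :
    FreeAlgebra.lift ℂ x (monomial w) = (w.map x).prod := by
  rw [monomial, map_list_prod, List.map_map]
  congr 2
  ext j
  simp

lemma lift_comp_algHom {A B : Type*} [Ring A] [Algebra ℂ A] [Ring B] [Algebra ℂ B]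
    (φ : A →ₐ[ℂ] B) (x : Fin m → A) (p : NCP m) :
    FreeAlgebra.lift ℂ (fun j => φ (x j)) p = φ (FreeAlgebra.lift ℂ x p) := by
  have : FreeAlgebra.lift ℂ (fun j => φ (x j)) = φ.comp (FreeAlgebra.lift ℂ x) := by
    ext j; simp
  exact congr($this p)

/-- The symmetric algebra is generated by the classes of polynomials, and these are spanned by
words, so traces of words suffice. Scalar multiples are products with constants. -/
theorem TrP0_induction {motive : TrP0 m → Prop} (hc : ∀ c : ℂ, motive (algebraMap ℂ _ c))
    (hw : ∀ w, motive (formalTrace (monomial w)))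
    (hmul : ∀ f g, motive f → motive g → motive (f * g))
    (hadd : ∀ f g, motive f → motive g → motive (f + g)) (f : TrP0 m) : motive f := by
  refine SymmetricAlgebra.induction ℂ (CycNCP m) hc (fun p => ?_) hmul hadd f
  obtain ⟨p, rfl⟩ := (commutatorSpan m).mkQ_surjective p
  have hp : p ∈ Submodule.span ℂ (Set.range (monomial (m := m))) := by
    rw [span_monomial]; trivial
  induction hp using Submodule.span_induction with
  | mem p hp => obtain ⟨w, rfl⟩ := hp; exact hw w
  | zero => simpa using hc 0
  | add a b _ _ ha hb => rw [map_add, map_add]; exact hadd _ _ ha hb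
  | smul c a _ ha =>
    rw [map_smul, map_smul, Algebra.smul_def]; exact hmul _ _ (hc c) ha

/-- The algebras may vary with the index, as needed for matrix approximations of `ℛ`. The hypothesis
includes the empty word, that is, convergence of the traces of the units. -/
theorem tendsto_eval0 {ι : Type*} {l : Filter ι} {B : ι → Type*} [∀ i, Ring (B i)]
    [∀ i, Algebra ℂ (B i)] {A : Type*} [Ring A] [Algebra ℂ A]
    (τ : ∀ i, B i →ₗ[ℂ] ℂ) (hτ : ∀ i a b, τ i (a * b) = τ i (b * a))
    (σ : A →ₗ[ℂ] ℂ) (hσ : ∀ a b, σ (a * b) = σ (b * a))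
    (x : ∀ i, Fin m → B i) (y : Fin m → A)
    (H : ∀ w : List (Fin m), Tendsto (fun i => τ i (w.map (x i)).prod) l (𝓝 (σ (w.map y).prod)))
    (g : TrP0 m) :
    Tendsto (fun i => eval0 (τ i) (hτ i) (x i) g) l (𝓝 (eval0 σ hσ y g)) := by
  induction g using TrP0_induction with
  | hc c => simp only [AlgHom.commutes]; exact tendsto_const_nhds
  | hw w => simpa only [eval0_formalTrace, lift_monomial] using H w
  | hmul f g hf hg => simp only [map_mul]; exact hf.mul hg
  | hadd f g hf hg => simp only [map_add]; exact hf.add hg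

theorem eval0_algHom {A B : Type*} [Ring A] [Algebra ℂ A] [Ring B] [Algebra ℂ B]
    (τ : A →ₗ[ℂ] ℂ) (hτ : ∀ a b, τ (a * b) = τ (b * a))
    (σ : B →ₗ[ℂ] ℂ) (hσ : ∀ a b, σ (a * b) = σ (b * a))
    (φ : A →ₐ[ℂ] B) (hφ : ∀ a, σ (φ a) = τ a) (x : Fin m → A) (g : TrP0 m) :
    eval0 σ hσ (fun j => φ (x j)) g = eval0 τ hτ x g := by
  induction g using TrP0_induction with
  | hc c => simp only [AlgHom.commutes]
  | hw w => rw [eval0_formalTrace, eval0_formalTrace, lift_comp_algHom, hφ]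
  | hmul f g hf hg => simp only [map_mul, hf, hg]
  | hadd f g hf hg => simp only [map_add, hf, hg]

theorem eval1_algHom {A B : Type*} [Ring A] [Algebra ℂ A] [Ring B] [Algebra ℂ B]
    (τ : A →ₗ[ℂ] ℂ) (hτ : ∀ a b, τ (a * b) = τ (b * a))
    (σ : B →ₗ[ℂ] ℂ) (hσ : ∀ a b, σ (a * b) = σ (b * a))
    (φ : A →ₐ[ℂ] B) (hφ : ∀ a, σ (φ a) = τ a) (x : Fin m → A) (g : TrP1 m) :
    eval1 σ hσ (fun j => φ (x j)) g = φ (eval1 τ hτ x g) := by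
  induction g using TensorProduct.induction_on with
  | zero => simp only [map_zero]
  | tmul f p => rw [eval1_tmul, eval1_tmul, eval0_algHom τ hτ σ hσ φ hφ, lift_comp_algHom, map_smul]
  | add f g hf hg => simp only [map_add, hf, hg]

end Moments

/-! ### Amplification of matrices -/

section Amplification

/-- The homomorphism `a ↦ a ⊗ 1` of matrix algebras, with the index set `ι × κ` relabelled. -/
def kroneckerOne {ι κ ν : Type*} [Fintype ι] [Fintype κ] [Fintype ν] [DecidableEq ι]
    [DecidableEq κ] [DecidableEq ν] (e : ι × κ ≃ ν) : Matrix ι ι ℂ →⋆ₐ[ℂ] Matrix ν ν ℂ where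
  toFun a := Matrix.reindexAlgEquiv ℂ ℂ e (a ⊗ₖ (1 : Matrix κ κ ℂ))
  map_one' := by rw [Matrix.one_kronecker_one, map_one]
  map_mul' a b := by rw [← map_mul, ← Matrix.mul_kronecker_mul, one_mul]
  map_zero' := by rw [Matrix.zero_kronecker, map_zero]
  map_add' a b := by rw [Matrix.add_kronecker, map_add]
  commutes' c := by
    rw [Algebra.algebraMap_eq_smul_one, Algebra.algebraMap_eq_smul_one, Matrix.smul_kronecker,
      map_smul, Matrix.one_kronecker_one, map_one]
  map_star' a := by
    rw [Matrix.star_eq_conjTranspose, Matrix.star_eq_conjTranspose, Matrix.coe_reindexAlgEquiv,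
      Matrix.conjTranspose_reindex, Matrix.conjTranspose_kronecker,
      Matrix.conjTranspose_one]

lemma trace_kroneckerOne {ι κ ν : Type*} [Fintype ι] [Fintype κ] [Fintype ν] [DecidableEq ι]
    [DecidableEq κ] [DecidableEq ν] (e : ι × κ ≃ ν) (a : Matrix ι ι ℂ) :
    (kroneckerOne e a).trace = a.trace * Fintype.card κ := by
  rw [← Matrix.trace_one, ← Matrix.trace_kronecker]
  exact e.symm.sum_comp (fun i => (a ⊗ₖ (1 : Matrix κ κ ℂ)).diag i)

/-- The amplification `a ↦ a ⊗ 1_k` from `M_N(ℂ)` to `M_{Nk}(ℂ)`. -/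
def amplify (N k : ℕ+) : Mat N →⋆ₐ[ℂ] Mat (N * k) :=
  kroneckerOne (finProdFinEquiv.trans (finCongr (PNat.mul_coe N k).symm))

lemma tauN_amplify (N k : ℕ+) (a : Mat N) : tauN (N * k) (amplify N k a) = tauN N a := by
  simp only [tauN, LinearMap.smul_apply, Matrix.traceLinearMap_apply, smul_eq_mul, amplify]
  rw [trace_kroneckerOne, PNat.mul_coe, Nat.cast_mul, Fintype.card_fin]
  have : ((k : ℕ) : ℂ) ≠ 0 := by exact_mod_cast k.ne_zero
  field_simp

lemma norm_amplify_le (N k : ℕ+) (a : Mat N) : ‖amplify N k a‖ ≤ ‖a‖ :=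
  NonUnitalStarAlgHom.norm_apply_le (amplify N k) a

variable {m : ℕ}

/-- The amplification of a tuple of self-adjoint matrices. -/
def amplifySa {N : ℕ+} (k : ℕ+) (x : SaMat m N) : SaMat m (N * k) :=
  fun j => ⟨amplify N k (x j), by
    rw [selfAdjoint.mem_iff, ← map_star, selfAdjoint.mem_iff.1 (x j).2]⟩

lemma norm_amplifySa_le {N : ℕ+} (k : ℕ+) (x : SaMat m N) : ‖amplifySa k x‖ ≤ ‖x‖ := by
  rw [pi_norm_le_iff_of_nonneg (norm_nonneg _)]
  exact fun j => (norm_amplify_le N k (x j)).trans (norm_le_pi_norm x j)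

lemma amplifySa_combo {N : ℕ+} (k : ℕ+) (x y : SaMat m N) (a b : ℝ) :
    amplifySa k (a • x + b • y) = a • amplifySa k x + b • amplifySa k y := by
  ext1 j
  apply Subtype.ext
  change amplify N k (((a : ℝ) • (x j : Mat N)) + b • (y j : Mat N)) =
    a • amplify N k (x j) + b • amplify N k (y j)
  rw [map_add, ← Complex.coe_smul, ← Complex.coe_smul, map_smul, map_smul, Complex.coe_smul,
    Complex.coe_smul]

namespace TrP

lemma evalMat_amplifySa {N : ℕ+} (k : ℕ+) (g : TrP0 m) (x : SaMat m N) :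
    evalMat g (amplifySa k x) = evalMat g x :=
  eval0_algHom _ _ _ _ (amplify N k).toAlgHom (tauN_amplify N k) _ g

lemma gradMat_amplifySa {N : ℕ+} (k : ℕ+) (g : TrP0 m) (x : SaMat m N) :
    gradMat g (amplifySa k x) = fun j => amplify N k (gradMat g x j) := by
  ext1 j
  exact eval1_algHom _ _ _ _ (amplify N k).toAlgHom (tauN_amplify N k) _ (gradOp j g)

end TrP

lemma norm2_amplify {N : ℕ+} (k : ℕ+) (y : Fin m → Mat N) :
    norm2 (fun j => amplify N k (y j)) = norm2 y := by
  simp only [norm2, ← map_star, ← map_mul, tauN_amplify]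

/-- A function that is invariant under amplification is bounded by its asymptotic supremum. -/
lemma le_ballLimsup {R : ℝ} (h : ∀ N : ℕ+, SaMat m N → ℝ≥0∞) {N : ℕ+} (x : SaMat m N)
    (hx : ‖x‖ ≤ R) (c : ℝ≥0∞) (H : ∀ k : ℕ+, c ≤ h (N * k) (amplifySa k x)) :
    c ≤ ballLimsup R h := by
  refine le_limsup_of_frequently_le ?_ (by isBoundedDefault)
  rw [frequently_atTop]
  intro M
  -- The multiples of `N` are cofinal, so a lower bound along them is a lower bound for the limsup.
  refine ⟨N * M, ?_, ?_⟩
  · exact PNat.coe_le_coe _ _ |>.1 (by rw [PNat.mul_coe]; exact Nat.le_mul_of_pos_left _ N.pos)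
  · exact (H M).trans (le_iSup₂ (f := fun (z : SaMat m (N * M)) (_ : ‖z‖ ≤ R) => h (N * M) z)
      (amplifySa M x) ((norm_amplifySa_le M x).trans hx))

namespace TrP

/-- Amplification turns the asymptotic seminorm into a bound at every fixed size. Without it, the
metric would not control the values on `M_N(ℂ)` for any given `N`. -/
lemma enorm_evalMat_sub_le {N : ℕ+} {R : ℝ} (f g : TrP0 m) (x : SaMat m N) (hx : ‖x‖ ≤ R) :
    ‖evalMat f x - evalMat g x‖ₑ ≤ dist0 R f g :=
  le_ballLimsup _ x hx _ fun k => by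
    rw [evalMat_sub, evalMat_amplifySa, evalMat_amplifySa]

lemma norm2_gradMat_sub_le {N : ℕ+} {R : ℝ} (f g : TrP0 m) (x : SaMat m N) (hx : ‖x‖ ≤ R) :
    ENNReal.ofReal (norm2 (gradMat f x - gradMat g x)) ≤ dist1 R f g :=
  le_ballLimsup _ x hx _ fun k => by
    rw [gradMat_amplifySa, gradMat_amplifySa, ← norm2_amplify k]
    apply le_of_eq
    congr 2
    ext1 j
    simp

end TrP

end Amplification

/-! ### Compression of a group von Neumann algebra to a finite subgroup -/

section Compression

variable {G : Type*} [Group G]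

/-- The unit vector `δ_g ∈ ℓ²(G)`. -/
def delta (g : G) : EllTwo G := rightTranslation g⁻¹ deltaOne

lemma inner_rightTranslation (g : G) (ξ η : EllTwo G) :
    ⟪rightTranslation g ξ, rightTranslation g η⟫_ℂ = ⟪ξ, η⟫_ℂ :=
  (permUnitary (Equiv.mulRight g⁻¹)).inner_map_map ξ η

lemma inner_delta (g : G) (ξ : EllTwo G) : ⟪delta g, ξ⟫_ℂ = ξ g := by
  rw [delta, ← inner_rightTranslation g]
  have : rightTranslation g (rightTranslation g⁻¹ deltaOne) = (deltaOne : EllTwo G) := by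
    ext h
    simp [rightTranslation_apply]
  rw [this, inner_deltaOne, rightTranslation_apply, one_mul]

open Classical in
lemma deltaOne_apply (h : G) : (deltaOne : EllTwo G) h = if h = 1 then 1 else 0 := by
  simp [deltaOne, lp.single_apply, Pi.single_apply]

open Classical in
lemma delta_apply (g h : G) : delta g h = if h = g then 1 else 0 := by
  rw [delta, rightTranslation_apply, deltaOne_apply]
  simp only [mul_inv_eq_one]

lemma orthonormal_delta : Orthonormal ℂ (delta (G := G)) := by
  classical
  rw [orthonormal_iff_ite]
  intro g h
  rw [inner_delta, delta_apply]

variable {ι : Type*} [Fintype ι] [DecidableEq ι] (i : ι ↪ G)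

/-- The isometry `ℓ²(ι) → ℓ²(G)` induced by an injection `ι → G`. -/
def ellTwoIncl : EuclideanSpace ℂ ι →ₗᵢ[ℂ] EllTwo G :=
  ((EuclideanSpace.basisFun ι ℂ).toBasis.constr ℂ fun a => delta (i a)).isometryOfOrthonormal
    (v := (EuclideanSpace.basisFun ι ℂ).toBasis)
    (by simp) (by
      have : (fun a => delta (i a)) = delta ∘ i := rfl
      convert! orthonormal_delta.comp i i.injective using 1
      ext1 a
      simp)

lemma ellTwoIncl_single (a : ι) : ellTwoIncl i (EuclideanSpace.single a 1) = delta (i a) := by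
  have := (EuclideanSpace.basisFun ι ℂ).toBasis.constr_basis ℂ (fun a => delta (i a)) a
  rwa [OrthonormalBasis.coe_toBasis, EuclideanSpace.basisFun_apply] at this

/-- The isometry `ellTwoIncl` as a continuous linear map. -/
def ellTwoInclL : EuclideanSpace ℂ ι →L[ℂ] EllTwo G := (ellTwoIncl i).toContinuousLinearMap

lemma norm_ellTwoInclL_le : ‖ellTwoInclL i‖ ≤ 1 := (ellTwoIncl i).norm_toContinuousLinearMap_le

lemma adjoint_ellTwoInclL_apply (ξ : EllTwo G) (a : ι) :
    (ContinuousLinearMap.adjoint (ellTwoInclL i) ξ) a = ξ (i a) := by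
  have h : ⟪EuclideanSpace.single a (1 : ℂ), ContinuousLinearMap.adjoint (ellTwoInclL i) ξ⟫_ℂ =
      ξ (i a) := by
    rw [ContinuousLinearMap.adjoint_inner_right, ← inner_delta, ← ellTwoIncl_single]
    rfl
  rw [← h, EuclideanSpace.inner_single_left]
  simp

/-- The projection of `ℓ²(G)` onto the vectors supported in the range of `i`. -/
def coordProj : EllTwo G →L[ℂ] EllTwo G :=
  ellTwoInclL i ∘L ContinuousLinearMap.adjoint (ellTwoInclL i)

lemma norm_coordProj_apply_le (ξ : EllTwo G) : ‖coordProj i ξ‖ ≤ ‖ξ‖ := by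
  have h1 : ‖coordProj i ξ‖ = ‖ContinuousLinearMap.adjoint (ellTwoInclL i) ξ‖ :=
    (ellTwoIncl i).norm_map _
  have h2 : ‖ContinuousLinearMap.adjoint (ellTwoInclL i)‖ ≤ 1 := by
    rw [LinearIsometryEquiv.norm_map]; exact norm_ellTwoInclL_le i
  rw [h1]
  simpa using ContinuousLinearMap.le_of_opNorm_le _ h2 ξ

open Classical in
lemma coordProj_apply (ξ : EllTwo G) (g : G) :
    coordProj i ξ g = if g ∈ Set.range i then ξ g else 0 := by
  rw [← inner_delta, coordProj, ContinuousLinearMap.comp_apply,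
    ← ContinuousLinearMap.adjoint_inner_left, PiLp.inner_apply]
  simp only [adjoint_ellTwoInclL_apply, delta_apply]
  split_ifs with hg
  · obtain ⟨a, rfl⟩ := hg
    rw [Finset.sum_eq_single a]
    · simp
    · intro b _ hb
      simp [i.injective.eq_iff, hb]
    · simp
  · refine Finset.sum_eq_zero fun a _ => ?_
    rw [if_neg fun h => hg ⟨a, h⟩]
    simp

lemma coordProj_eq_sum (ξ : EllTwo G) [DecidableEq G] :
    coordProj i ξ = ∑ g ∈ Finset.univ.map i, lp.single 2 g (ξ g) := by
  ext g
  rw [coordProj_apply, lp.coeFn_sum, Finset.sum_apply]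
  simp only [lp.single_apply, Pi.single_apply]
  rw [Finset.sum_ite_eq]
  simp

/-- A subgroup is stable under right multiplication by its elements; an arbitrary finite subset
would not do. -/
lemma coordProj_rightTranslation {H : Subgroup G} (hH : Set.range i = H) {g : G} (hg : g ∈ H)
    (ξ : EllTwo G) :
    coordProj i (rightTranslation g ξ) = rightTranslation g (coordProj i ξ) := by
  ext h
  have e : h * g ∈ Set.range i ↔ h ∈ Set.range i := by
    rw [hH]; exact H.mul_mem_cancel_right hg
  rw [coordProj_apply, rightTranslation_apply, rightTranslation_apply, coordProj_apply]
  by_cases h1 : h ∈ Set.range i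
  · rw [if_pos h1, if_pos (e.2 h1)]
  · rw [if_neg h1, if_neg (mt e.1 h1)]

/-- The compression of an operator in `L(G)` to `ℓ²(ι) ⊆ ℓ²(G)`, as a matrix. -/
def compress : GroupVN G →ₗ[ℂ] Matrix ι ι ℂ where
  toFun T := (Matrix.toEuclideanCLM (n := ι) (𝕜 := ℂ)).symm
    (ContinuousLinearMap.adjoint (ellTwoInclL i) ∘L T.op ∘L ellTwoInclL i)
  map_add' S T := by
    rw [← map_add]; congr 1; ext1 ξ
    simp
  map_smul' c T := by
    rw [RingHom.id_apply, ← map_smul]; congr 1; ext1 ξ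
    simp

lemma toEuclideanCLM_compress (T : GroupVN G) :
    Matrix.toEuclideanCLM (n := ι) (𝕜 := ℂ) (compress i T) =
      ContinuousLinearMap.adjoint (ellTwoInclL i) ∘L T.op ∘L ellTwoInclL i :=
  (Matrix.toEuclideanCLM (n := ι) (𝕜 := ℂ)).apply_symm_apply _

lemma compress_star (T : GroupVN G) : compress i (star T) = star (compress i T) := by
  apply (Matrix.toEuclideanCLM (n := ι) (𝕜 := ℂ)).injective
  refine Eq.trans ?_ (map_star (Matrix.toEuclideanCLM (n := ι) (𝕜 := ℂ)) (compress i T)).symm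
  change Matrix.toEuclideanCLM (n := ι) (𝕜 := ℂ) _ = _
  rw [toEuclideanCLM_compress, toEuclideanCLM_compress,
    ContinuousLinearMap.star_eq_adjoint, ContinuousLinearMap.adjoint_comp,
    ContinuousLinearMap.adjoint_comp, ContinuousLinearMap.adjoint_adjoint]
  rfl

lemma norm_compress_le (T : GroupVN G) : ‖compress i T‖ ≤ ‖T‖ := by
  rw [← Matrix.l2_opNorm_toEuclideanCLM, toEuclideanCLM_compress]
  have h1 := norm_ellTwoInclL_le i
  have h2 : ‖ContinuousLinearMap.adjoint (ellTwoInclL i)‖ ≤ 1 := by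
    rw [LinearIsometryEquiv.norm_map]; exact h1
  calc _ ≤ ‖ContinuousLinearMap.adjoint (ellTwoInclL i)‖ * (‖T.op‖ * ‖ellTwoInclL i‖) :=
        (ContinuousLinearMap.opNorm_comp_le _ _).trans (mul_le_mul_of_nonneg_left
          (ContinuousLinearMap.opNorm_comp_le _ _) (norm_nonneg _))
    _ ≤ 1 * (‖T.op‖ * 1) := by gcongr
    _ = ‖T‖ := by rw [mul_one, one_mul]; rfl

/-- With `V` the inclusion and `P = V V*`, this is `V (V* T₁ V) ⋯ (V* Tₙ V) = (P T₁) ⋯ (P Tₙ) V`,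
which moves the computation to `ℓ²(G)`. -/
lemma ellTwoInclL_compress_list (l : List (GroupVN G)) (v : EuclideanSpace ℂ ι) :
    ellTwoInclL i (Matrix.toEuclideanCLM (n := ι) (𝕜 := ℂ) (l.map (compress i)).prod v) =
      (l.map fun T => coordProj i ∘L T.op).prod (ellTwoInclL i v) := by
  induction l with
  | nil => simp
  | cons T l ih =>
    simp only [List.map_cons, List.prod_cons, map_mul, toEuclideanCLM_compress]
    rw [mul_apply_eq_comp, mul_apply_eq_comp, ← ih]
    rfl

lemma coordProj_list_rightTranslation {H : Subgroup G} (hH : Set.range i = H) {g : G} (hg : g ∈ H)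
    (l : List (GroupVN G)) (ξ : EllTwo G) :
    (l.map fun T => coordProj i ∘L T.op).prod (rightTranslation g ξ) =
      rightTranslation g ((l.map fun T => coordProj i ∘L T.op).prod ξ) := by
  induction l with
  | nil => simp
  | cons T l ih =>
    simp only [List.map_cons, List.prod_cons, mul_apply_eq_comp, ContinuousLinearMap.comp_apply]
    rw [ih, commute_rightTranslation, coordProj_rightTranslation i hH hg]

/-- The operators `P T` commute with right translations by the subgroup, and these carry `δ_1` to
every basis vector of its `ℓ²` space. So all diagonal entries agree with the one at `δ_1`. -/
theorem trace_compress_list {H : Subgroup G} (hH : Set.range i = H) (l : List (GroupVN G)) :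
    (l.map (compress i)).prod.trace =
      Fintype.card ι * ⟪deltaOne, (l.map fun T => coordProj i ∘L T.op).prod deltaOne⟫_ℂ := by
  have key : ∀ a : ι, (l.map (compress i)).prod a a =
      ⟪deltaOne, (l.map fun T => coordProj i ∘L T.op).prod deltaOne⟫_ℂ := by
    intro a
    have ha : (i a)⁻¹ ∈ H := H.inv_mem (by
      have : i a ∈ Set.range i := ⟨a, rfl⟩
      rwa [hH] at this)
    have h1 : (l.map (compress i)).prod a a = ⟪EuclideanSpace.single a (1 : ℂ),
        Matrix.toEuclideanCLM (n := ι) (𝕜 := ℂ) (l.map (compress i)).prod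
          (EuclideanSpace.single a 1)⟫_ℂ := by
      rw [EuclideanSpace.inner_single_left]
      simp [Matrix.ofLp_toEuclideanCLM]
    rw [h1, ← (ellTwoIncl i).inner_map_map]
    have h2 := ellTwoInclL_compress_list i l (EuclideanSpace.single a 1)
    change ⟪_, ellTwoInclL i _⟫_ℂ = _
    rw [h2]
    change ⟪_, (_ : EllTwo G →L[ℂ] EllTwo G) (ellTwoIncl i _)⟫_ℂ = _
    rw [ellTwoIncl_single, delta, coordProj_list_rightTranslation i hH ha, inner_rightTranslation]
  simp only [Matrix.trace, Matrix.diag, key, Finset.sum_const, Finset.card_univ, nsmul_eq_mul]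

/-- The projections are contractions that tend strongly to the identity, and strong limits of
bounded sequences pass through products, from the right to the left. -/
theorem tendsto_coordProj_list {κ : ℕ → Type*} [∀ k, Fintype (κ k)] [∀ k, DecidableEq (κ k)]
    (i : ∀ k, κ k ↪ G) (hi : Tendsto (fun k => Finset.univ.map (i k)) atTop atTop)
    (l : List (GroupVN G)) (ξ : EllTwo G) :
    Tendsto (fun k => (l.map fun T => coordProj (i k) ∘L T.op).prod ξ) atTop
      (𝓝 ((l.map fun T => T.op).prod ξ)) := by
  classical
  have hP : ∀ η : EllTwo G, Tendsto (fun k => coordProj (i k) η) atTop (𝓝 η) := by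
    intro η
    simp only [coordProj_eq_sum]
    exact (lp.hasSum_single (p := 2) (by norm_num) η).comp hi
  induction l with
  | nil => simp
  | cons T l ih =>
    simp only [List.map_cons, List.prod_cons, mul_apply_eq_comp, ContinuousLinearMap.comp_apply]
    set η := (l.map fun T => T.op).prod ξ
    have h1 := ((T.op.continuous.tendsto η).comp ih)
    have h2 : Tendsto (fun k => coordProj (i k) (T.op ((l.map fun T => coordProj (i k) ∘L
        T.op).prod ξ)) - coordProj (i k) (T.op η)) atTop (𝓝 0) := by
      refine squeeze_zero_norm (fun k => ?_) (tendsto_iff_norm_sub_tendsto_zero.1 h1)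
      rw [← map_sub]
      exact norm_coordProj_apply_le _ _
    simpa using h2.add (hP (T.op η))

end Compression

/-! ### Approximation of `ℛ` and `ℛ^ω` by matrices -/

section FinitePerm

/-- The homomorphism from the permutations of a finite set to the finitely supported permutations
of `ℕ` induced by an injection. -/
def finitePermHom {α : Type*} [Finite α] (f : α ↪ ℕ) : Equiv.Perm α →* finitePerm :=
  (Equiv.Perm.viaEmbeddingHom f).codRestrict finitePerm fun σ =>
    (Set.finite_range f).subset fun n hn => by
      by_contra h
      exact hn (Equiv.Perm.viaEmbedding_apply_of_notMem σ f n h)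

lemma finitePermHom_injective {α : Type*} [Finite α] (f : α ↪ ℕ) :
    Function.Injective (finitePermHom f) := fun _ _ h =>
  Equiv.Perm.viaEmbeddingHom_injective f congr($(h).1)

lemma mem_range_finitePermHom (k : ℕ) (σ : finitePerm) :
    σ ∈ Set.range (finitePermHom (Fin.valEmbedding (n := k))) ↔ ∀ n, k ≤ n → σ.1 n = n := by
  constructor
  · rintro ⟨π, rfl⟩ n hn
    refine Equiv.Perm.viaEmbedding_apply_of_notMem π _ n ?_
    rintro ⟨a, rfl⟩
    exact absurd a.2 (not_lt.2 hn)
  · intro h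
    have hmap : ∀ a : Fin k, σ.1 a < k := by
      intro a
      by_contra hlt
      -- If `σ a ≥ k`, then `σ` fixes `σ a`, and injectivity gives `σ a = a < k`.
      have h1 := h _ (not_lt.1 hlt)
      have h2 := σ.1.injective h1
      exact hlt (h2.trans_lt a.2)
    let φ : Fin k → Fin k := fun a => ⟨σ.1 a, hmap a⟩
    have hφ : Function.Injective φ := fun a b hab =>
      Fin.ext (σ.1.injective (Fin.mk.inj hab))
    refine ⟨Equiv.ofBijective φ (Finite.injective_iff_bijective.1 hφ), Subtype.ext ?_⟩
    ext n
    by_cases hn : n < k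
    · exact Equiv.Perm.viaEmbedding_apply _ (Fin.valEmbedding (n := k)) ⟨n, hn⟩
    · rw [h n (not_lt.1 hn)]
      refine Equiv.Perm.viaEmbedding_apply_of_notMem _ _ n ?_
      rintro ⟨a, rfl⟩
      exact hn a.2

/-- An enumeration of the permutations that fix every `n ≥ k`. -/
def permEnum (k : ℕ) : Fin (Fintype.card (Equiv.Perm (Fin k))) ↪ finitePerm :=
  (Fintype.equivFin (Equiv.Perm (Fin k))).symm.toEmbedding.trans
    ⟨finitePermHom Fin.valEmbedding, finitePermHom_injective _⟩

lemma range_permEnum (k : ℕ) :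
    Set.range (permEnum k) = (finitePermHom (Fin.valEmbedding (n := k))).range := by
  rw [MonoidHom.coe_range]
  exact (Fintype.equivFin (Equiv.Perm (Fin k))).symm.surjective.range_comp
    (finitePermHom (Fin.valEmbedding (n := k)))

/-- The subgroups increase with `k`, and each finitely supported permutation lies in one of them
because its support is bounded. -/
lemma tendsto_permEnum : Tendsto (fun k => Finset.univ.map (permEnum k)) atTop atTop := by
  have hmem : ∀ k σ, σ ∈ Finset.univ.map (permEnum k) ↔ ∀ n, k ≤ n → σ.1 n = n := by
    intro k σ
    rw [← mem_range_finitePermHom, ← MonoidHom.coe_range, ← range_permEnum]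
    simp
  refine tendsto_atTop_finset_of_monotone ?_ fun σ => ?_
  · intro k l hkl σ hσ
    rw [hmem] at hσ ⊢
    exact fun n hn => hσ n (hkl.trans hn)
  · obtain ⟨B, hB⟩ := (show {n | σ.1 n ≠ n}.Finite from σ.2).bddAbove
    refine ⟨B + 1, (hmem _ _).2 fun n hn => ?_⟩
    by_contra h
    have := hB h
    omega

end FinitePerm

/-- The hyperfinite factor is approximated in moments by matrices, through linear contractions. -/
theorem exists_compression : ∃ (N : ℕ → ℕ+) (E : ∀ k, HyperfiniteR →ₗ[ℂ] Mat (N k)),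
    (∀ k T, E k (star T) = star (E k T)) ∧ (∀ k T, ‖E k T‖ ≤ ‖T‖) ∧
    ∀ l : List HyperfiniteR, Tendsto (fun k => tauN (N k) (l.map (E k)).prod) atTop
      (𝓝 (HyperfiniteR.trace l.prod)) := by
  -- The matrices have size `k!`, the dimension of `ℓ²` of the permutations of `k` points.
  refine ⟨fun k => ⟨Fintype.card (Equiv.Perm (Fin k)), Fintype.card_pos⟩,
    fun k => compress (permEnum k), fun k T => compress_star _ T, fun k T => norm_compress_le _ T,
    fun l => ?_⟩
  have hop : (GroupVN.op (G := finitePerm) l.prod) = (l.map (GroupVN.op (G := finitePerm))).prod :=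
    map_list_prod (groupVN finitePerm).toStarSubalgebra.subtype l
  have h := (tendsto_const_nhds (x := (deltaOne : EllTwo finitePerm))).inner (𝕜 := ℂ)
    (tendsto_coordProj_list permEnum tendsto_permEnum l deltaOne)
  have htr : HyperfiniteR.trace l.prod =
      ⟪deltaOne, (l.map (GroupVN.op (G := finitePerm))).prod deltaOne⟫_ℂ := by
    rw [← hop]; rfl
  rw [htr]
  refine h.congr fun k => ?_
  have h2 := trace_compress_list (permEnum k) (range_permEnum k) l
  have h0 : ((Fintype.card (Equiv.Perm (Fin k)) : ℕ) : ℂ) ≠ 0 := by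
    exact_mod_cast Fintype.card_ne_zero
  rw [Fintype.card_fin] at h2
  change _ = ((Fintype.card (Equiv.Perm (Fin k)) : ℕ) : ℂ)⁻¹ * _
  rw [eq_comm, inv_mul_eq_iff_eq_mul₀ h0]
  exact h2

/-! ### From matrices to the ultrapower -/

section Ultrapower

variable {m : ℕ} {ω : Ultrafilter ℕ}

theorem tendsto_eval0_ultra (x : Fin m → boundedSeq) (g : TrP0 m) :
    Tendsto (fun n => eval0 HyperfiniteR.trace HyperfiniteR.trace_comm (fun j => (x j).1 n) g) ω
      (𝓝 (eval0 (ultraTrace ω) ultraTrace_comm (fun j => UltraR.mk ω (x j)) g)) := by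
  refine tendsto_eval0 (fun _ => HyperfiniteR.trace) (fun _ => HyperfiniteR.trace_comm) _ _
    (fun n j => (x j).1 n) _ (fun w => ?_) g
  have h1 : (w.map fun j => UltraR.mk ω (x j)).prod = UltraR.mk ω (w.map x).prod := by
    rw [map_list_prod, List.map_map]; rfl
  rw [h1]
  refine (tendsto_ultraTraceFun ω (w.map x).prod).congr fun n => ?_
  have h2 := map_list_prod ((Pi.evalRingHom (fun _ : ℕ => HyperfiniteR) n).comp
    boundedSeq.subtype.toRingHom) (w.map x)
  rw [List.map_map] at h2
  exact congrArg HyperfiniteR.trace h2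

/-- Any bounded lift may be replaced by its real part, since its class is already self-adjoint. -/
lemma exists_selfAdjoint_rep (X : Fin m → selfAdjoint (UltraR ω)) :
    ∃ (x : Fin m → boundedSeq) (R : ℝ), (∀ j n, star ((x j).1 n) = (x j).1 n) ∧
      (∀ j n, ‖(x j).1 n‖ ≤ R) ∧ ∀ j, UltraR.mk ω (x j) = X j := by
  choose z hz using fun j => UltraR.mk_surjective (X j : UltraR ω)
  let x : Fin m → boundedSeq := fun j => (2⁻¹ : ℂ) • (z j + star (z j))
  have hx : ∀ j, UltraR.mk ω (x j) = X j := by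
    intro j
    have h1 : UltraR.mk ω (star (z j)) = X j := by
      rw [← UltraR.star_mk, hz]
      exact selfAdjoint.mem_iff.1 (X j).2
    rw [map_smul, map_add, h1, hz, ← two_smul ℂ, smul_smul]
    norm_num
  choose C hC using fun j => (x j).2
  refine ⟨x, ∑ j, |C j|, fun j n => ?_, fun j n => ?_, hx⟩
  · change star ((2⁻¹ : ℂ) • ((z j).1 n + star ((z j).1 n))) = (2⁻¹ : ℂ) • ((z j).1 n +
      star ((z j).1 n))
    rw [star_smul, star_add, star_star, add_comm (star _)]
    simp
  · exact ((hC j n).trans (le_abs_self _)).trans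
      (Finset.single_le_sum (f := fun j => |C j|) (fun _ _ => abs_nonneg _) (Finset.mem_univ j))

/-- Closed conditions on the values of a trace polynomial pass from matrices to `ℛ^ω`. -/
theorem exists_radius_evalUltra_mem (X Y : Fin m → selfAdjoint (UltraR ω)) (a b : ℝ) :
    ∃ R : ℝ, 0 < R ∧ ∀ (C : Set (ℂ × ℂ × ℂ)), IsClosed C → ∀ g : TrP0 m,
      (∀ (N : ℕ+) (x y : SaMat m N), ‖x‖ ≤ R → ‖y‖ ≤ R → ‖a • x + b • y‖ ≤ R →
        (TrP.evalMat g x, TrP.evalMat g y, TrP.evalMat g (a • x + b • y)) ∈ C) →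
      (TrP.evalUltra g X, TrP.evalUltra g Y, TrP.evalUltra g (a • X + b • Y)) ∈ C := by
  obtain ⟨x, R₁, hx, hR₁, hX⟩ := exists_selfAdjoint_rep X
  obtain ⟨y, R₂, hy, hR₂, hY⟩ := exists_selfAdjoint_rep Y
  set S := |R₁| + |R₂| + 1
  have hS : 0 < S := by positivity
  -- `S` bounds both lifted tuples, and the extra factor leaves room for their combination. The
  -- radius does not depend on `C` and `g`, so that `g` may later run through approximations of an
  -- element of `T01 m`.
  refine ⟨S * (1 + |a| + |b|), by positivity, fun C hC g H => ?_⟩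
  have hXY : ∀ j, UltraR.mk ω ((a : ℂ) • x j + (b : ℂ) • y j) = (a • X + b • Y) j := by
    intro j
    rw [map_add, map_smul, map_smul, hX, hY, Complex.coe_smul, Complex.coe_smul]
    rfl
  have t1 := tendsto_eval0_ultra (ω := ω) x g
  have t2 := tendsto_eval0_ultra (ω := ω) y g
  have t3 := tendsto_eval0_ultra (ω := ω) (fun j => (a : ℂ) • x j + (b : ℂ) • y j) g
  simp only [hX, hY, hXY] at t1 t2 t3
  -- Two limits are taken in turn: along `ω`, which reduces to tuples in `ℛ`, and along the
  -- compressions, which reduces to matrices.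
  refine hC.mem_of_tendsto (t1.prodMk_nhds (t2.prodMk_nhds t3)) (Eventually.of_forall fun n => ?_)
  obtain ⟨N, E, hstar, hnorm, hlim⟩ := exists_compression
  have hE : ∀ z : Fin m → HyperfiniteR, Tendsto (fun k => eval0 (tauN (N k)) (tauN_comm (N k))
      (fun j => E k (z j)) g) atTop (𝓝 (eval0 HyperfiniteR.trace HyperfiniteR.trace_comm z g)) := by
    intro z
    refine tendsto_eval0 (fun k => tauN (N k)) (fun k => tauN_comm (N k)) _ _
      (fun k j => E k (z j)) z (fun w => ?_) g
    simpa [List.map_map, Function.comp_def] using hlim (w.map z)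
  refine hC.mem_of_tendsto ((hE fun j => (x j).1 n).prodMk_nhds
    ((hE fun j => (y j).1 n).prodMk_nhds (hE fun j => ((a : ℂ) • x j + (b : ℂ) • y j).1 n)))
    (Eventually.of_forall fun k => ?_)
  let x' : SaMat m (N k) := fun j => ⟨E k ((x j).1 n), by
    rw [selfAdjoint.mem_iff, ← hstar, hx]⟩
  let y' : SaMat m (N k) := fun j => ⟨E k ((y j).1 n), by
    rw [selfAdjoint.mem_iff, ← hstar, hy]⟩
  have hx' : ‖x'‖ ≤ S := by
    rw [pi_norm_le_iff_of_nonneg hS.le]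
    refine fun j => (hnorm k _).trans ((hR₁ j n).trans ?_)
    have := le_abs_self R₁
    have := abs_nonneg R₂
    linarith
  have hy' : ‖y'‖ ≤ S := by
    rw [pi_norm_le_iff_of_nonneg hS.le]
    refine fun j => (hnorm k _).trans ((hR₂ j n).trans ?_)
    have := le_abs_self R₂
    have := abs_nonneg R₁
    linarith
  have hle : S ≤ S * (1 + |a| + |b|) := by
    nlinarith [mul_nonneg hS.le (abs_nonneg a), mul_nonneg hS.le (abs_nonneg b)]
  have h3 : ‖a • x' + b • y'‖ ≤ S * (1 + |a| + |b|) := by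
    refine (norm_add_le _ _).trans ?_
    rw [norm_smul, norm_smul, Real.norm_eq_abs, Real.norm_eq_abs]
    nlinarith [mul_le_mul_of_nonneg_left hx' (abs_nonneg a),
      mul_le_mul_of_nonneg_left hy' (abs_nonneg b)]
  have h4 := H (N k) x' y' (hx'.trans hle) (hy'.trans hle) h3
  -- Linearity of the compression is what makes the third tuple the same combination of the first
  -- two.
  have h5 : (fun j => E k (((a : ℂ) • x j + (b : ℂ) • y j).1 n)) =
      fun j => ((a • x' + b • y') j : Mat (N k)) := by
    ext1 j
    change E k ((a : ℂ) • (x j).1 n + (b : ℂ) • (y j).1 n) = a • E k ((x j).1 n) +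
      b • E k ((y j).1 n)
    rw [map_add, map_smul, map_smul, Complex.coe_smul, Complex.coe_smul]
  rw [h5]
  exact h4

end Ultrapower

/-! ### Uniform approximation of the elements of `𝒯^{0,1}` by trace polynomials -/

section

variable {m : ℕ}

lemma norm_entry_le_norm2 {N : ℕ+} (y : Fin m → Mat N) (j : Fin m) (a b : Fin N) :
    ‖y j a b‖ ≤ √((N : ℕ) : ℝ) * norm2 y := by
  have hN : √((N : ℕ) : ℝ) ≠ 0 := by
    rw [Real.sqrt_ne_zero'] ; exact_mod_cast N.pos
  rw [norm2_eq, Real.sqrt_inv, mul_inv_cancel_left₀ hN]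
  exact PiLp.norm_apply_le (WithLp.toLp 2 (fun i : Fin m × Fin N × Fin N => y i.1 i.2.1 i.2.2))
    (j, a, b)

lemma continuous_tauN (N : ℕ+) : Continuous (tauN N) :=
  LinearMap.continuous_of_finiteDimensional _

lemma continuous_norm2 {N : ℕ+} : Continuous (norm2 (m := m) (N := N)) := by
  unfold norm2
  refine Real.continuous_sqrt.comp (continuous_finsetSum _ fun j _ => ?_)
  exact Complex.continuous_re.comp ((continuous_tauN N).comp
    ((continuous_star.comp (continuous_apply j)).mul (continuous_apply j)))

namespace TrP

lemma edist_eq (f g : TrP0 m) : edist f g =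
    ∑' n : ℕ, 2⁻¹ ^ (n + 1) * (min 1 (dist0 (n + 1) f g) + min 1 (dist1 (n + 1) f g)) := rfl

/-- One term is at most the whole series, and `ε ≤ 1` makes the truncation by `min 1` harmless. -/
lemma dist_lt_of_edist_lt {f g : TrP0 m} {n : ℕ} {ε : ℝ≥0∞} (hε : ε ≤ 1)
    (h : edist f g < 2⁻¹ ^ (n + 1) * ε) : dist0 (n + 1) f g < ε ∧ dist1 (n + 1) f g < ε := by
  have h1 := (ENNReal.le_tsum n).trans_lt ((edist_eq f g).symm.trans_lt h)
  have h2 : min 1 (dist0 (n + 1) f g) + min 1 (dist1 (n + 1) f g) < ε :=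
    lt_of_mul_lt_mul_left' h1
  constructor
  · exact (min_lt_iff.1 (le_self_add.trans_lt h2)).resolve_left (not_lt.2 hε)
  · exact (min_lt_iff.1 (le_add_self.trans_lt h2)).resolve_left (not_lt.2 hε)

/-- A single term of the metric, of integer radius at least `R`, controls the ball of radius `R` at
all matrix sizes at once. -/
theorem eventually_uniformity (R : ℝ) {ε : ℝ} (hε : 0 < ε) :
    ∀ᶠ p : TrP0 m × TrP0 m in 𝓤 (TrP0 m), ∀ (N : ℕ+) (x : SaMat m N), ‖x‖ ≤ R →
      ‖evalMat p.1 x - evalMat p.2 x‖ ≤ ε ∧ norm2 (gradMat p.1 x - gradMat p.2 x) ≤ ε := by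
  obtain ⟨n, hn⟩ := exists_nat_ge R
  have hε' : 0 < min 1 (ENNReal.ofReal ε) := lt_min one_pos (ENNReal.ofReal_pos.2 hε)
  have hpos : (0 : ℝ≥0∞) < 2⁻¹ ^ (n + 1) * min 1 (ENNReal.ofReal ε) :=
    ENNReal.mul_pos (pow_ne_zero _ (by simp)) hε'.ne'
  filter_upwards [edist_mem_uniformity hpos] with p hp N x hx
  obtain ⟨h0, h1⟩ := dist_lt_of_edist_lt (min_le_left _ _) hp
  have hx' : ‖x‖ ≤ (n + 1 : ℝ) := by linarith
  constructor
  · have := (enorm_evalMat_sub_le p.1 p.2 x hx').trans (h0.le.trans (min_le_right _ _))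
    rwa [← ofReal_norm, ENNReal.ofReal_le_ofReal_iff hε.le] at this
  · have := (norm2_gradMat_sub_le p.1 p.2 x hx').trans (h1.le.trans (min_le_right _ _))
    rwa [ENNReal.ofReal_le_ofReal_iff hε.le] at this

lemma uniformContinuous_evalMat {N : ℕ+} (x : SaMat m N) :
    UniformContinuous fun g : TrP0 m => evalMat g x := by
  refine Metric.uniformity_basis_dist_le.tendsto_right_iff.2 fun ε hε => ?_
  filter_upwards [eventually_uniformity ‖x‖ hε] with p hp
  exact (dist_eq_norm _ _).trans_le (hp N x le_rfl).1

lemma uniformContinuous_gradMat {N : ℕ+} (x : SaMat m N) :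
    UniformContinuous fun g : TrP0 m => gradMat g x := by
  refine uniformContinuous_pi.2 fun j => uniformContinuous_pi.2 fun a =>
    uniformContinuous_pi.2 fun b => ?_
  have hN : 0 < √((N : ℕ) : ℝ) := Real.sqrt_pos.2 (by exact_mod_cast N.pos)
  refine Metric.uniformity_basis_dist_le.tendsto_right_iff.2 fun ε hε => ?_
  filter_upwards [eventually_uniformity ‖x‖ (div_pos hε hN)] with p hp
  refine (dist_eq_norm _ _).trans_le ((norm_entry_le_norm2 (gradMat p.1 x - gradMat p.2 x) j a
    b).trans ?_)
  rw [mul_comm, ← le_div_iff₀ hN]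
  exact (hp N x le_rfl).2

lemma evalUltra_sub {ω : Ultrafilter ℕ} (f g : TrP0 m) (X : Fin m → selfAdjoint (UltraR ω)) :
    evalUltra (f - g) X = evalUltra f X - evalUltra g X := map_sub _ _ _

lemma uniformContinuous_evalUltra {ω : Ultrafilter ℕ} (X : Fin m → selfAdjoint (UltraR ω)) :
    UniformContinuous fun g : TrP0 m => evalUltra g X := by
  -- Only the first value of the triple is used; the second tuple and the coefficients are
  -- arbitrary.
  obtain ⟨R, -, hR⟩ := exists_radius_evalUltra_mem X X 0 0
  refine Metric.uniformity_basis_dist_le.tendsto_right_iff.2 fun ε hε => ?_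
  filter_upwards [eventually_uniformity R hε] with p hp
  rw [dist_eq_norm, ← evalUltra_sub]
  refine hR {z | ‖z.1‖ ≤ ε} (isClosed_le (by fun_prop) continuous_const) _ ?_
  intro N x y hx _ _
  rw [Set.mem_ofPred_eq, evalMat_sub]
  exact (hp N x hx).1

end TrP

/-! ### Approximation of elements of the completion, and transfer of convexity -/

namespace T01

/-- The filter of trace polynomials that approximate `f ∈ 𝒯^{0,1}`. -/
def approx (f : T01 m) : Filter (TrP0 m) :=
  comap (fun g : TrP0 m => (g : UniformSpace.Completion (TrP0 m)))
    (@nhds (UniformSpace.Completion (TrP0 m)) _ f)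

instance neBot_approx (f : T01 m) : NeBot (approx f) :=
  UniformSpace.Completion.isDenseInducing_coe.comap_nhds_neBot f

lemma cauchy_approx (f : T01 m) : Cauchy (approx f) :=
  Cauchy.comap' (cauchy_nhds (α := UniformSpace.Completion (TrP0 m)))
    (UniformSpace.Completion.isUniformInducing_coe (TrP0 m)).comap_uniformity.le (neBot_approx f)

/-- `UniformSpace.Completion.extension` is the extension by continuity only for uniformly continuous
maps and a default value otherwise. The uniform continuity of the evaluations thus gives the values
of `f` their meaning. -/
lemma tendsto_extension {β : Type*} [UniformSpace β] [CompleteSpace β] [T0Space β]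
    {φ : TrP0 m → β} (hφ : UniformContinuous φ) (f : T01 m) :
    Tendsto φ (approx f) (𝓝 (UniformSpace.Completion.extension φ f)) := by
  have h := (UniformSpace.Completion.continuous_extension (f := φ)).tendsto f
  exact (h.comp tendsto_comap).congr fun g => UniformSpace.Completion.extension_coe hφ g

lemma tendsto_evalMat (f : T01 m) {N : ℕ+} (x : SaMat m N) :
    Tendsto (fun g => TrP.evalMat g x) (approx f) (𝓝 (f.evalMat x)) :=
  tendsto_extension (TrP.uniformContinuous_evalMat x) f

lemma tendsto_gradMat (f : T01 m) {N : ℕ+} (x : SaMat m N) :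
    Tendsto (fun g => TrP.gradMat g x) (approx f) (𝓝 (f.gradMat x)) :=
  tendsto_extension (TrP.uniformContinuous_gradMat x) f

lemma tendsto_evalUltra (f : T01 m) {ω : Ultrafilter ℕ} (X : Fin m → selfAdjoint (UltraR ω)) :
    Tendsto (fun g => TrP.evalUltra g X) (approx f) (𝓝 (f.evalUltra X)) :=
  tendsto_extension (TrP.uniformContinuous_evalUltra X) f

/-- Two members of a small set of the Cauchy filter are uniformly close on the ball; letting one of
them tend to `f` at each point keeps the closed inequality. -/
theorem eventually_approx (f : T01 m) (R : ℝ) {ε : ℝ} (hε : 0 < ε) :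
    ∀ᶠ g in approx f, ∀ (N : ℕ+) (x : SaMat m N), ‖x‖ ≤ R →
      ‖TrP.evalMat g x - f.evalMat x‖ ≤ ε ∧ norm2 (TrP.gradMat g x - f.gradMat x) ≤ ε := by
  have h := ((cauchy_approx f).2 (TrP.eventually_uniformity (m := m) R hε))
  obtain ⟨s, hs, hsub⟩ := mem_prod_same_iff.1 h
  filter_upwards [hs] with g hg N x hx
  constructor
  · refine le_of_tendsto ((tendsto_const_nhds.sub (f.tendsto_evalMat x)).norm) ?_
    filter_upwards [hs] with g' hg'
    exact (hsub (Set.mk_mem_prod hg hg') N x hx).1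
  · refine le_of_tendsto ((continuous_norm2.tendsto _).comp
      (tendsto_const_nhds.sub (f.tendsto_gradMat x))) ?_
    filter_upwards [hs] with g' hg'
    exact (hsub (Set.mk_mem_prod hg hg') N x hx).2

lemma evalMat_amplifySa (f : T01 m) {N : ℕ+} (k : ℕ+) (x : SaMat m N) :
    f.evalMat (amplifySa k x) = f.evalMat x :=
  tendsto_nhds_unique ((f.tendsto_evalMat _).congr fun g => TrP.evalMat_amplifySa k g x)
    (f.tendsto_evalMat x)

/-- A trace polynomial close to `f` satisfies the convexity inequality on a ball of matrices up to
`ε`. This is a closed condition on three values, so it passes to `ℛ^ω`. -/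
theorem convexOn_evalUltra (f : T01 m) (ω : Ultrafilter ℕ)
    (h : ∀ N : ℕ+, ConvexOn ℝ Set.univ (fun x : SaMat m N => (f.evalMat x).re)) :
    ConvexOn ℝ Set.univ (fun X : Fin m → selfAdjoint (UltraR ω) => (f.evalUltra X).re) := by
  refine ⟨convex_univ, fun X _ Y _ a b ha hb hab => le_of_forall_pos_le_add fun ε hε => ?_⟩
  obtain ⟨R, -, hR⟩ := exists_radius_evalUltra_mem X Y a b
  have re : ∀ Z : Fin m → selfAdjoint (UltraR ω), Tendsto (fun g => (TrP.evalUltra g Z).re)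
      (approx f) (𝓝 (f.evalUltra Z).re) := fun Z =>
    (Complex.continuous_re.tendsto _).comp (f.tendsto_evalUltra Z)
  refine le_of_tendsto_of_tendsto (re _)
    (((re X).const_mul a |>.add ((re Y).const_mul b)).add_const ε) ?_
  filter_upwards [f.eventually_approx R (half_pos hε)] with g hg
  refine hR {z | z.2.2.re ≤ a * z.1.re + b * z.2.1.re + ε}
    (isClosed_le (by fun_prop) (by fun_prop)) g ?_
  intro N x y hx hy hxy
  have key : ∀ z : SaMat m N, ‖z‖ ≤ R →
      |(TrP.evalMat g z).re - (f.evalMat z).re| ≤ ε / 2 := fun z hz => by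
    rw [← Complex.sub_re]
    exact (Complex.abs_re_le_norm _).trans (hg N z hz).1
  have h1 := abs_le.1 (key x hx)
  have h2 := abs_le.1 (key y hy)
  have h3 := abs_le.1 (key _ hxy)
  have h4 := (h N).2 (Set.mem_univ x) (Set.mem_univ y) ha hb hab
  simp only [smul_eq_mul] at h4
  rw [Set.mem_ofPred_eq]
  have e1 := mul_le_mul_of_nonneg_left h1.1 ha
  have e2 := mul_le_mul_of_nonneg_left h2.1 hb
  -- The two endpoints together cost `ε / 2`, since the weights sum to one, and the combination
  -- costs another `ε / 2`.
  have e3 : ε / 2 = a * (ε / 2) + b * (ε / 2) := by rw [← add_mul, hab, one_mul]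
  linarith

/-- The limsup says nothing about `V N` at the given size, but `f` takes the same value at `x` and
at its amplification, where `V (N * M)` is close to `f`. Amplification is linear, so convexity of `V
(N * M)` comes back to `x` and `y` up to `ε`. -/
theorem convexOn_evalMat_of_isRepresentedBy (f : T01 m) {V : ∀ N : ℕ+, SaMat m N → ℝ}
    (hV : ∀ N, ConvexOn ℝ Set.univ (V N)) (hf : f.IsRepresentedBy V) (N : ℕ+) :
    ConvexOn ℝ Set.univ (fun x : SaMat m N => (f.evalMat x).re) := by
  refine ⟨convex_univ, fun x _ y _ a b ha hb hab => le_of_forall_pos_le_add fun ε hε => ?_⟩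
  set R := ‖x‖ + ‖y‖ + ‖a • x + b • y‖ + 1
  have hR := hf R (by positivity)
  have hlt := eventually_lt_of_limsup_lt (hR.trans_lt (ENNReal.ofReal_pos.2 (half_pos hε)))
  obtain ⟨M, hM⟩ := eventually_atTop.1 hlt
  have hle : M ≤ N * M :=
    (PNat.coe_le_coe _ _).1 (by rw [PNat.mul_coe]; exact Nat.le_mul_of_pos_left _ N.pos)
  have key : ∀ z : SaMat m N, ‖z‖ ≤ R →
      |V (N * M) (amplifySa M z) - (f.evalMat z).re| ≤ ε / 2 := by
    intro z hz
    have h1 := ((le_iSup₂ (f := fun (z : SaMat m (N * M)) (_ : ‖z‖ ≤ R) =>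
      ‖(V (N * M) z : ℂ) - f.evalMat z‖ₑ) (amplifySa M z)
      ((norm_amplifySa_le M z).trans hz)).trans_lt (hM _ hle)).le
    rw [← ofReal_norm, ENNReal.ofReal_le_ofReal_iff (half_pos hε).le,
      evalMat_amplifySa] at h1
    have h2 := (Complex.abs_re_le_norm _).trans h1
    rwa [Complex.sub_re, Complex.ofReal_re] at h2
  have nx := norm_nonneg x
  have ny := norm_nonneg y
  have nz := norm_nonneg (a • x + b • y)
  have h1 := abs_le.1 (key x (by linarith))
  have h2 := abs_le.1 (key y (by linarith))
  have h3 := abs_le.1 (key (a • x + b • y) (by linarith))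
  have h4 := (hV (N * M)).2 (Set.mem_univ (amplifySa M x)) (Set.mem_univ (amplifySa M y)) ha hb hab
  rw [← amplifySa_combo] at h4
  simp only [smul_eq_mul] at h4 ⊢
  have e1 := mul_le_mul_of_nonneg_left h1.2 ha
  have e2 := mul_le_mul_of_nonneg_left h2.2 hb
  have e3 : ε / 2 = a * (ε / 2) + b * (ε / 2) := by rw [← add_mul, hab, one_mul]
  linarith

end T01

end

/-! ### The gradient of an element of `𝒯^{0,1}` on matrices -/

section

variable {m : ℕ}

lemma eval1_smul {A : Type*} [Ring A] [Algebra ℂ A] (τ : A →ₗ[ℂ] ℂ)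
    (hτ : ∀ a b, τ (a * b) = τ (b * a)) (x : Fin m → A) (f : TrP0 m) (p : TrP1 m) :
    eval1 τ hτ x (f • p) = eval0 τ hτ x f • eval1 τ hτ x p := by
  induction p using TensorProduct.induction_on with
  | zero => simp only [smul_zero, map_zero]
  | tmul g p => rw [TensorProduct.smul_tmul', eval1_tmul, eval1_tmul, smul_eq_mul, map_mul, mul_smul]
  | add p q hp hq => simp only [smul_add, map_add, hp, hq]

/-- A shortcut that lets instance search find the normed space structure of `SaMat m N →L[ℝ] ℂ`. -/
instance (N : ℕ+) : SeminormedAddCommGroup (selfAdjoint (Mat N)) :=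
  NormedAddCommGroup.toSeminormedAddCommGroup

/-- The coordinate `y ↦ y_j` as a continuous linear map into the matrices. -/
def saCoord (N : ℕ+) (j : Fin m) : SaMat m N →L[ℝ] Mat N :=
  LinearMap.mkContinuous
    { toFun := fun y => (y j : Mat N)
      map_add' := fun _ _ => rfl
      map_smul' := fun _ _ => rfl } 1
    fun y => by rw [one_mul]; exact norm_le_pi_norm y j

@[simp] lemma saCoord_apply {N : ℕ+} (j : Fin m) (y : SaMat m N) : saCoord N j y = y j := rfl

/-- The normalized trace as a continuous real-linear map. -/
def tauL (N : ℕ+) : Mat N →L[ℝ] ℂ where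
  toLinearMap := (tauN N).restrictScalars ℝ
  cont := continuous_tauN N

@[simp] lemma tauL_apply {N : ℕ+} (a : Mat N) : tauL N a = tauN N a := rfl

/-- The linear functional `y ↦ ∑_j τ_N(Y_j y_j)`, which depends linearly on `Y`. -/
def pairing (N : ℕ+) : (Fin m → Mat N) →ₗ[ℝ] (SaMat m N →L[ℝ] ℂ) where
  toFun Y := ∑ j, tauL N ∘L (ContinuousLinearMap.mul ℝ (Mat N) (Y j)) ∘L saCoord N j
  map_add' Y Z := by
    ext y
    simp [Finset.sum_add_distrib]
  map_smul' c Y := by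
    ext y
    simp [Finset.mul_sum]

lemma pairing_apply {N : ℕ+} (Y : Fin m → Mat N) (y : SaMat m N) :
    pairing N Y y = ∑ j, tauN N (Y j * y j) := by
  simp [pairing]

lemma exists_bound_of_finiteDimensional {E F : Type*} [NormedAddCommGroup E] [NormedSpace ℝ E]
    [FiniteDimensional ℝ E] [NormedAddCommGroup F] [NormedSpace ℝ F] (L : E →ₗ[ℝ] F) :
    ∃ C : ℝ, 0 < C ∧ ∀ v, ‖L v‖ ≤ C * ‖v‖ :=
  L.toContinuousLinearMap.bound

/-- A linear map on a finite-dimensional space is bounded, and `norm2` is a multiple of the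
Euclidean norm of the entries. The constant may depend on `N`, which stays fixed where it is used.
-/
lemma exists_norm_pairing_le (N : ℕ+) :
    ∃ C : ℝ, 0 < C ∧ ∀ Y : Fin m → Mat N, ‖pairing N Y‖ ≤ C * norm2 Y := by
  let unpack : EuclideanSpace ℂ (Fin m × Fin N × Fin N) →ₗ[ℝ] (Fin m → Mat N) :=
    { toFun := fun v j => Matrix.of fun a b => v (j, a, b)
      map_add' := fun _ _ => rfl
      map_smul' := fun _ _ => rfl }
  obtain ⟨C, hC, h⟩ := exists_bound_of_finiteDimensional (F := SaMat m N →L[ℝ] ℂ)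
    (pairing N ∘ₗ unpack)
  have hN : 0 < √((N : ℕ) : ℝ) := Real.sqrt_pos.2 (by exact_mod_cast N.pos)
  refine ⟨C * √((N : ℕ) : ℝ), by positivity, fun Y => ?_⟩
  rw [norm2_eq, Real.sqrt_inv, mul_assoc, mul_inv_cancel_left₀ hN.ne']
  exact h (WithLp.toLp 2 (fun i : Fin m × Fin N × Fin N => Y i.1 i.2.1 i.2.2))

/-- The product rule replaces one letter at a time by its increment, and cyclicity of the trace
brings the increment to the end. What remains is the cyclically rotated word of `cyclicDerivWord`.
-/
lemma hasFDerivAt_tauN_word {N : ℕ+} (w : List (Fin m)) (x : SaMat m N) :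
    HasFDerivAt (fun x : SaMat m N => tauN N (w.map fun j => (x j : Mat N)).prod)
      (pairing N fun j => FreeAlgebra.lift ℂ (fun j => (x j : Mat N)) (cyclicDerivWord j w)) x := by
  have h := (tauL N).hasFDerivAt.comp x (HasFDerivAt.list_prod' (l := w) (x := x)
    (f := fun j (x : SaMat m N) => (x j : Mat N)) (f' := fun j => saCoord N j)
    fun j _ => (saCoord N j).hasFDerivAt)
  refine h.congr_fderiv ?_
  ext y
  rw [pairing_apply]
  simp only [cyclicDerivWord, map_sum, apply_ite (FreeAlgebra.lift ℂ fun j => (x j : Mat N)),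
    map_zero, lift_monomial, Finset.sum_mul, ite_mul, zero_mul]
  -- For each position `k` in the word, only the index `j = w_k` contributes.
  rw [Finset.sum_comm]
  simp only [apply_ite (tauN N), map_zero, Finset.sum_ite_eq, Finset.mem_univ, if_true]
  simp only [ContinuousLinearMap.comp_apply, sum_apply, map_sum, tauL_apply]
  refine Finset.sum_congr rfl fun k _ => ?_
  rw [List.map_append, List.prod_append, mul_assoc, tauN_comm]
  simp [mul_assoc, List.map_drop, List.map_take]

namespace TrP

/-- Both sides obey the product rule in `g`, so it suffices that they agree on traces of words. -/
theorem hasFDerivAt_evalMat {N : ℕ+} (g : TrP0 m) (x : SaMat m N) :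
    HasFDerivAt (fun x : SaMat m N => evalMat g x) (pairing N (gradMat g x)) x := by
  induction g using TrP0_induction with
  | hc c =>
    have h : gradMat (algebraMap ℂ (TrP0 m) c) x = 0 := by
      ext1 j
      rw [gradMat, Derivation.map_algebraMap, map_zero, Pi.zero_apply]
    rw [h, map_zero]
    simpa only [evalMat, AlgHom.commutes] using hasFDerivAt_const _ x
  | hw w =>
    have h : gradMat (formalTrace (monomial w)) x = fun j =>
        FreeAlgebra.lift ℂ (fun j => (x j : Mat N)) (cyclicDerivWord j w) := by
      ext1 j
      rw [gradMat, gradOp_formalTrace, cyclicDeriv_monomial, eval1_tmul, map_one, one_smul]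
    rw [h]
    simpa only [evalMat, eval0_formalTrace, lift_monomial] using hasFDerivAt_tauN_word w x
  | hmul f g hf hg =>
    have h := hf.mul hg
    simp only [evalMat, map_mul] at h ⊢
    refine h.congr_fderiv ?_
    ext y
    simp only [add_apply, smul_apply, pairing_apply,
      gradMat, Derivation.leibniz, map_add, eval1_smul, add_mul, Finset.sum_add_distrib,
      smul_mul_assoc, map_smul, Finset.smul_sum]
  | hadd f g hf hg =>
    have h := hf.add hg
    have e : gradMat (f + g) x = gradMat f x + gradMat g x := by
      ext1 j
      simp only [gradMat, map_add, Pi.add_apply]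
    rw [e, map_add]
    simp only [evalMat, map_add] at h ⊢
    exact h

end TrP

lemma tauN_star {N : ℕ+} (a : Mat N) : tauN N (star a) = star (tauN N a) := by
  simp [tauN, Matrix.star_eq_conjTranspose, Matrix.trace_conjTranspose]

lemma eq_zero_of_norm2_eq_zero {N : ℕ+} {y : Fin m → Mat N} (h : norm2 y = 0) :
    y = 0 := by
  ext j a b
  have := norm_entry_le_norm2 y j a b
  rw [h, mul_zero] at this
  exact norm_le_zero_iff.1 this

/-- Testing against `y_j = i (Y_j - Y_j*)` gives `‖y‖₂² = -2 Im ∑_j τ_N(Y_j y_j) = 0`. -/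
lemma star_eq_of_pairing_im_eq_zero {N : ℕ+} (Y : Fin m → Mat N)
    (h : ∀ y : SaMat m N, (pairing N Y y).im = 0) (j : Fin m) : star (Y j) = Y j := by
  let y : SaMat m N := fun j => ⟨Complex.I • (Y j - star (Y j)), by
    rw [selfAdjoint.mem_iff, star_smul, star_sub, star_star, ← neg_sub, smul_neg, ← neg_smul]
    simp⟩
  have hy : ∀ j, star (y j : Mat N) = y j := fun j => selfAdjoint.mem_iff.1 (y j).2
  have h1 : ∀ j, tauN N (star (y j : Mat N) * y j) =
      Complex.I * (tauN N (Y j * y j) - star (tauN N (Y j * y j))) := by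
    intro j
    rw [← tauN_star, star_mul, hy, tauN_comm N (y j) (star _), ← map_sub, ← sub_mul,
      ← smul_eq_mul (a := Complex.I), ← map_smul, ← smul_mul_assoc]
  have h2 : ∑ j, tauN N (star (y j : Mat N) * y j) = 0 := by
    have h3 := h y
    rw [pairing_apply, ← Complex.conj_eq_iff_im, map_sum] at h3
    rw [Finset.sum_congr rfl fun j _ => h1 j, ← Finset.mul_sum, Finset.sum_sub_distrib, sub_eq_zero.2,
      mul_zero]
    exact h3.symm
  have h4 : norm2 (fun j => (y j : Mat N)) = 0 := by
    rw [norm2, ← Complex.re_sum, h2]; simp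
  have h5 := congrFun (eq_zero_of_norm2_eq_zero h4) j
  have h6 : Complex.I • (Y j - star (Y j)) = 0 := h5
  rw [smul_eq_zero, or_iff_right Complex.I_ne_zero, sub_eq_zero] at h6
  exact h6.symm

namespace T01

/-- Along `approx f` the values converge pointwise and the derivatives converge uniformly on a ball
around `x`, so the derivative of the limit is the limit of the derivatives. -/
theorem hasFDerivAt_evalMat (f : T01 m) {N : ℕ+} (x : SaMat m N) :
    HasFDerivAt (fun x : SaMat m N => f.evalMat x) (pairing N (f.gradMat x)) x := by
  obtain ⟨C, hC, hbound⟩ := exists_norm_pairing_le (m := m) N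
  refine hasFDerivAt_of_tendstoUniformlyOn (l := approx f) (f := fun g x => TrP.evalMat g x)
    (f' := fun g x => pairing N (TrP.gradMat g x)) (g' := fun x => pairing N (f.gradMat x))
    (Metric.isOpen_ball (x := (0 : SaMat m N)) (ε := ‖x‖ + 1)) ?_
    (fun g x _ => TrP.hasFDerivAt_evalMat g x) (fun x _ => f.tendsto_evalMat x) (by simp)
  rw [Metric.tendstoUniformlyOn_iff]
  intro ε hε
  -- `C` converts `norm2` into the operator norm of the functional, and the factor 2 makes the
  -- inequality strict.
  filter_upwards [f.eventually_approx (‖x‖ + 1) (ε := ε / (2 * C)) (by positivity)] with g hg z hz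
  rw [dist_comm, dist_eq_norm, ← map_sub]
  refine (hbound _).trans_lt ?_
  have h1 := (hg N z (mem_ball_zero_iff.1 hz).le).2
  have h2 := mul_le_mul_of_nonneg_left h1 hC.le
  have h3 : C * (ε / (2 * C)) = ε / 2 := by field_simp
  linarith

lemma star_gradMat (f : T01 m) (hf : f.IsReal) {N : ℕ+} (x : SaMat m N) (j : Fin m) :
    star (f.gradMat x j) = f.gradMat x j := by
  refine star_eq_of_pairing_im_eq_zero _ (fun y => ?_) j
  have h := Complex.imCLM.hasFDerivAt.comp x (f.hasFDerivAt_evalMat x)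
  have h0 : (fun x : SaMat m N => Complex.imCLM (f.evalMat x)) = fun _ => (0 : ℝ) :=
    funext fun x => hf N x
  have h1 : HasFDerivAt (fun x : SaMat m N => Complex.imCLM (f.evalMat x))
      (0 : SaMat m N →L[ℝ] ℝ) x := by
    rw [h0]; exact hasFDerivAt_const 0 x
  exact congr($(h.unique h1) y)

/-- The gradient of a real-valued `f`, as a tuple of self-adjoint matrices. -/
def gradSa (f : T01 m) (hf : f.IsReal) (N : ℕ+) (x : SaMat m N) : SaMat m N :=
  fun j => ⟨f.gradMat x j, selfAdjoint.mem_iff.2 (f.star_gradMat hf x j)⟩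

lemma hasFDerivAt_re_evalMat (f : T01 m) {N : ℕ+} (x : SaMat m N) :
    HasFDerivAt (fun x : SaMat m N => (f.evalMat x).re)
      (Complex.reCLM ∘L pairing N (f.gradMat x)) x :=
  Complex.reCLM.hasFDerivAt.comp x (f.hasFDerivAt_evalMat x)

lemma isNormalizedGradient_gradSa (f : T01 m) (hf : f.IsReal) (N : ℕ+) :
    IsNormalizedGradient (fun x : SaMat m N => (f.evalMat x).re) (f.gradSa hf N) := by
  intro x y
  rw [(f.hasFDerivAt_re_evalMat x).fderiv, ContinuousLinearMap.comp_apply, pairing_apply, inner2,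
    map_sum]
  rfl

lemma isRepresentedBy_re (f : T01 m) (hf : f.IsReal) :
    f.IsRepresentedBy fun _ x => (f.evalMat x).re := by
  intro R _
  have h : ∀ (N : ℕ+) (x : SaMat m N), ‖((f.evalMat x).re : ℂ) - f.evalMat x‖ₑ = 0 := by
    intro N x
    rw [enorm_eq_zero, sub_eq_zero]
    exact Complex.ext (Complex.ofReal_re _) ((Complex.ofReal_im _).trans (hf N x).symm)
  simp only [h, ballLimsup_zero]

lemma isGradRepresentedBy_gradSa (f : T01 m) (hf : f.IsReal) :
    f.IsGradRepresentedBy (f.gradSa hf) := by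
  intro R _
  have h : ∀ (N : ℕ+) (x : SaMat m N), ENNReal.ofReal
      (norm2 ((fun j => (f.gradSa hf N x j : Mat N)) - f.gradMat x)) = 0 := by
    intro N x
    have : (fun j => (f.gradSa hf N x j : Mat N)) - f.gradMat x = 0 := sub_self _
    rw [this, norm2_zero, ENNReal.ofReal_zero]
  simp only [h, ballLimsup_zero]

end T01

end

/-! ### Systems of matrix units -/

section MatrixUnits

variable {ι A : Type*} [Fintype ι] [Ring A] [Algebra ℂ A] [StarRing A]

/-- The linear map `x ↦ ∑ x_ij w_i w_j*` defined by a family `w`. -/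
def unitSystemMap (w : ι → A) : Matrix ι ι ℂ →ₗ[ℂ] A where
  toFun x := ∑ i, ∑ j, x i j • (w i * star (w j))
  map_add' x y := by simp [add_smul, Finset.sum_add_distrib]
  map_smul' c x := by simp [mul_smul, Finset.smul_sum]

variable {w : ι → A} {q : A}

lemma unitSystemMap_apply (x : Matrix ι ι ℂ) :
    unitSystemMap w x = ∑ i, ∑ j, x i j • (w i * star (w j)) := rfl

lemma unitSystemMap_star [StarModule ℂ A] (x : Matrix ι ι ℂ) :
    unitSystemMap w (star x) = star (unitSystemMap w x) := by
  simp only [unitSystemMap_apply, star_sum, star_smul, star_mul, star_star, Matrix.star_apply]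
  exact Finset.sum_comm

/-- The family `w` is the first column of a system of matrix units, `w i * star (w j)` being the
unit at `(i, j)`. The diagonal units need not sum to one, so the homomorphism need not be unital. -/
lemma unitSystemMap_mul [DecidableEq ι]
    (hw : ∀ j k, star (w j) * w k = if j = k then q else 0)
    (hq : ∀ i, w i * q = w i) (x y : Matrix ι ι ℂ) :
    unitSystemMap w (x * y) = unitSystemMap w x * unitSystemMap w y := by
  have h : ∀ i j k l, (w i * star (w j)) * (w k * star (w l)) =
      if j = k then w i * star (w l) else 0 := by
    intro i j k l
    rw [mul_assoc, ← mul_assoc (star (w j)), hw]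
    split_ifs with hjk
    · rw [← mul_assoc, hq]
    · simp
  simp only [unitSystemMap_apply, Matrix.mul_apply, Finset.sum_smul]
  rw [Finset.sum_mul]
  refine Finset.sum_congr rfl fun i _ => ?_
  rw [Finset.sum_comm, Finset.sum_mul]
  refine Finset.sum_congr rfl fun j _ => ?_
  rw [Finset.mul_sum]
  refine ((Finset.sum_eq_single j (fun k _ hk => ?_) (by simp)).trans ?_).symm
  · rw [Finset.mul_sum]
    refine Finset.sum_eq_zero fun l _ => ?_
    rw [smul_mul_smul_comm, h, if_neg hk.symm, smul_zero]
  · rw [Finset.mul_sum]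
    refine Finset.sum_congr rfl fun l _ => ?_
    rw [smul_mul_smul_comm, h, if_pos rfl]

lemma trace_unitSystemMap [DecidableEq ι]
    (hw : ∀ j k, star (w j) * w k = if j = k then q else 0)
    (τ : A →ₗ[ℂ] ℂ) (hτ : ∀ a b, τ (a * b) = τ (b * a)) (x : Matrix ι ι ℂ) :
    τ (unitSystemMap w x) = x.trace * τ q := by
  simp only [unitSystemMap_apply, map_sum, map_smul, hτ (w _), hw, apply_ite τ, map_zero,
    smul_eq_mul, mul_ite, mul_zero, Finset.sum_ite_eq', Finset.mem_univ, if_true, Matrix.trace,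
    Matrix.diag, Finset.sum_mul]

end MatrixUnits

lemma unitSystem_idempotent {ι A : Type*} [DecidableEq ι] [Nonempty ι] [Ring A] [StarRing A]
    {w : ι → A} {q : A} (hw : ∀ j k, star (w j) * w k = if j = k then q else 0)
    (hq : ∀ i, w i * q = w i) : star q * q = q := by
  obtain ⟨i⟩ := ‹Nonempty ι›
  have h1 : star (w i) * w i = q := by simp [hw]
  have h2 : star q = q := by rw [← h1, star_mul, star_star]
  rw [h2]
  nth_rw 1 [← h1]
  rw [mul_assoc, hq, h1]

/-- `q` is a projection and `‖w i‖² = ‖q‖`. The crude bound is independent of `w`, hence uniform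
over a sequence of such systems. -/
lemma norm_unitSystemMap_le {ι A : Type*} [Fintype ι] [DecidableEq ι] [Nonempty ι] [NormedRing A]
    [NormedAlgebra ℂ A] [StarRing A] [CStarRing A] {w : ι → A} {q : A}
    (hw : ∀ j k, star (w j) * w k = if j = k then q else 0)
    (hq : ∀ i, w i * q = w i) (x : Matrix ι ι ℂ) :
    ‖unitSystemMap w x‖ ≤ ∑ i, ∑ j, ‖x i j‖ := by
  have h1 : ‖q‖ ≤ 1 := by
    have h := CStarRing.norm_star_mul_self (x := q)
    rw [unitSystem_idempotent hw hq] at h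
    nlinarith [norm_nonneg q]
  have h2 : ∀ i, ‖w i‖ ≤ 1 := by
    intro i
    have h := CStarRing.norm_star_mul_self (x := w i)
    rw [hw, if_pos rfl] at h
    nlinarith [norm_nonneg (w i)]
  refine (norm_sum_le _ _).trans (Finset.sum_le_sum fun i _ => (norm_sum_le _ _).trans
    (Finset.sum_le_sum fun j _ => ?_))
  rw [norm_smul]
  refine mul_le_of_le_one_right (norm_nonneg _) ((norm_mul_le _ _).trans ?_)
  rw [norm_star]
  exact mul_le_one₀ (h2 i) (norm_nonneg _) (h2 j)

/-! ### Matrix units in group von Neumann algebras -/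

section GroupUnitary

variable {G : Type*} [Group G]

lemma leftTranslation_mul (g h : G) :
    leftTranslation (g * h) = leftTranslation g * leftTranslation h := by
  ext ξ k
  rw [mul_apply_eq_comp]
  simp only [leftTranslation_apply, mul_inv_rev, mul_assoc]

lemma leftTranslation_one : leftTranslation (1 : G) = 1 := by
  ext ξ k
  simp [leftTranslation_apply]

variable (G) in
/-- The canonical unitaries `λ_g` of `L(G)`. -/
def groupUnitary : G →* GroupVN G where
  toFun g := ⟨leftTranslation g, by
    have h : leftTranslation g ∈ (groupVN G : Set (EllTwo G →L[ℂ] EllTwo G)) := by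
      rw [coe_groupVN]
      exact Set.subset_centralizer_centralizer ⟨g, rfl⟩
    exact h⟩
  map_one' := Subtype.ext leftTranslation_one
  map_mul' g h := Subtype.ext (leftTranslation_mul g h)

lemma star_groupUnitary (g : G) : star (groupUnitary G g) = groupUnitary G g⁻¹ :=
  Subtype.ext (star_leftTranslation g)

open Classical in
lemma groupTrace_groupUnitary (g : G) :
    groupTrace (groupUnitary G g) = if g = 1 then 1 else 0 := by
  change ⟪deltaOne, leftTranslation g deltaOne⟫_ℂ = _
  rw [inner_deltaOne, leftTranslation_apply, deltaOne_apply, mul_one]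
  simp only [inv_eq_one]

end GroupUnitary

/-! ### The wreath product of `ℤ/K` by the permutations of `ι` -/

section Wreath

variable {ι : Type*} {K : ℕ}

/-- The permutation `(i, s) ↦ (i, s + a_i)`. -/
def shiftPerm (a : ι → ZMod K) : Equiv.Perm (ι × ZMod K) :=
  Equiv.prodShear (Equiv.refl ι) fun i => Equiv.addRight (a i)

/-- The permutation `(i, s) ↦ (σ i, s)`. -/
def blockPerm (σ : Equiv.Perm ι) : Equiv.Perm (ι × ZMod K) := Equiv.prodCongr σ (Equiv.refl _)

@[simp] lemma shiftPerm_apply (a : ι → ZMod K) (p : ι × ZMod K) :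
    shiftPerm a p = (p.1, p.2 + a p.1) := rfl

@[simp] lemma blockPerm_apply (σ : Equiv.Perm ι) (p : ι × ZMod K) :
    blockPerm σ p = (σ p.1, p.2) := rfl

lemma shiftPerm_add (a b : ι → ZMod K) : shiftPerm (a + b) = shiftPerm a * shiftPerm b := by
  ext p <;> simp [add_comm, add_left_comm]

lemma shiftPerm_zero : shiftPerm (0 : ι → ZMod K) = 1 := by
  ext p <;> simp

lemma shiftPerm_eq_one {a : ι → ZMod K} : shiftPerm a = 1 ↔ a = 0 := by
  refine ⟨fun h => ?_, fun h => h ▸ shiftPerm_zero⟩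
  ext1 i
  simpa using congr(($h (i, 0)).2)

lemma shiftPerm_neg (a : ι → ZMod K) : shiftPerm (-a) = (shiftPerm a)⁻¹ := by
  rw [eq_inv_iff_mul_eq_one, ← shiftPerm_add, neg_add_cancel, shiftPerm_zero]

lemma blockPerm_mul_shiftPerm (σ : Equiv.Perm ι) (a : ι → ZMod K) :
    blockPerm σ * shiftPerm a = shiftPerm (a ∘ σ.symm) * blockPerm σ := by
  ext p <;> simp

end Wreath

section ShiftUnitary

variable {ι : Type*} {K : ℕ} {G : Type*} [Group G] (F : Equiv.Perm (ι × ZMod K) →* G)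

/-- The unitary of `L(G)` of a shift. -/
def shiftUnitary (a : ι → ZMod K) : GroupVN G := groupUnitary G (F (shiftPerm a))

lemma shiftUnitary_add (a b : ι → ZMod K) :
    shiftUnitary F (a + b) = shiftUnitary F a * shiftUnitary F b := by
  rw [shiftUnitary, shiftPerm_add, map_mul, map_mul]; rfl

lemma star_shiftUnitary (a : ι → ZMod K) : star (shiftUnitary F a) = shiftUnitary F (-a) := by
  rw [shiftUnitary, shiftUnitary, star_groupUnitary, shiftPerm_neg, map_inv F]

end ShiftUnitary

/-! ### Spectral projections of the group of shifts -/

section Spectral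

variable {ι : Type*} [Fintype ι] [DecidableEq ι] {K : ℕ} [NeZero K]
  {G : Type*} [Group G] (F : Equiv.Perm (ι × ZMod K) →* G)

/-- The spectral projection of the group of shifts for the character of index `s`. -/
def spectralProj (s : ι → ZMod K) : GroupVN G :=
  (Fintype.card (ι → ZMod K) : ℂ)⁻¹ • ∑ a : ι → ZMod K,
    ZMod.stdAddChar (-(s ⬝ᵥ a)) • shiftUnitary F a

/-- Translating the summation index by `b` pulls out the character: the range of `spectralProj F s`
consists of joint eigenvectors of the shifts. -/
lemma shiftUnitary_mul_spectralProj (b s : ι → ZMod K) :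
    shiftUnitary F b * spectralProj F s = ZMod.stdAddChar (s ⬝ᵥ b) • spectralProj F s := by
  rw [spectralProj, mul_smul_comm, smul_comm]
  congr 1
  rw [Finset.mul_sum, Finset.smul_sum]
  refine Fintype.sum_equiv (Equiv.addLeft b) _ _ fun a => ?_
  rw [mul_smul_comm, ← shiftUnitary_add, smul_smul, ← AddChar.map_add_eq_mul, Equiv.coe_addLeft,
    dotProduct_add]
  congr 2
  ring

/-- Orthogonality of characters. A nonzero `s` gives a nontrivial character because the standard
character of `ℤ/K` is primitive. -/
lemma sum_stdAddChar_dotProduct (s : ι → ZMod K) :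
    ∑ a : ι → ZMod K, ZMod.stdAddChar (s ⬝ᵥ a) =
      if s = 0 then (Fintype.card (ι → ZMod K) : ℂ) else 0 := by
  split_ifs with hs
  · subst hs
    simp
  · obtain ⟨i, hi⟩ := Function.ne_iff.1 hs
    let ψ : AddChar (ι → ZMod K) ℂ :=
      { toFun := fun a => ZMod.stdAddChar (s ⬝ᵥ a)
        map_zero_eq_one' := by simp
        map_add_eq_mul' := fun a b => by rw [dotProduct_add, AddChar.map_add_eq_mul] }
    refine AddChar.sum_eq_zero_of_ne_one (ψ := ψ) fun h => ?_
    have h1 : ∀ b : ZMod K, ZMod.stdAddChar (s i * b) = (1 : ℂ) := fun b => by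
      have : ψ (Pi.single i b) = 1 := by rw [h]; rfl
      rw [← this]
      change _ = ZMod.stdAddChar (s ⬝ᵥ Pi.single i b)
      rw [dotProduct_single]
    refine ZMod.isPrimitive_stdAddChar K hi ?_
    ext b
    rw [AddChar.mulShift_apply, h1]; rfl

lemma spectralProj_mul (s t : ι → ZMod K) :
    spectralProj F t * spectralProj F s = if t = s then spectralProj F s else 0 := by
  have hc : (Fintype.card (ι → ZMod K) : ℂ) ≠ 0 := by exact_mod_cast Fintype.card_ne_zero
  conv_lhs => rw [spectralProj]
  rw [smul_mul_assoc, Finset.sum_mul]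
  have h : ∀ a : ι → ZMod K, (ZMod.stdAddChar (-(t ⬝ᵥ a)) • shiftUnitary F a) *
      spectralProj F s = ZMod.stdAddChar ((s - t) ⬝ᵥ a) • spectralProj F s := by
    intro a
    rw [smul_mul_assoc, shiftUnitary_mul_spectralProj, smul_smul, ← AddChar.map_add_eq_mul,
      sub_dotProduct]
    congr 2
    ring
  rw [Finset.sum_congr rfl fun a _ => h a, ← Finset.sum_smul, sum_stdAddChar_dotProduct]
  simp only [sub_eq_zero, eq_comm (a := s)]
  split_ifs with hst
  · rw [smul_smul, inv_mul_cancel₀ hc, one_smul]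
  · simp

lemma star_spectralProj (s : ι → ZMod K) : star (spectralProj F s) = spectralProj F s := by
  rw [spectralProj, star_smul, star_sum]
  congr 1
  · simp
  · refine Fintype.sum_equiv (Equiv.neg _) _ _ fun a => ?_
    rw [star_smul, star_shiftUnitary, Equiv.neg_apply, dotProduct_neg, neg_neg]
    congr 1
    rw [AddChar.map_neg_eq_conj]
    exact star_star _

/-- Conjugation by a block permutation permutes the coordinates of the shifts, hence those of the
characters. -/
lemma blockPerm_mul_spectralProj (σ : Equiv.Perm ι) (s : ι → ZMod K) :
    groupUnitary G (F (blockPerm σ)) * spectralProj F s =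
      spectralProj F (s ∘ σ.symm) * groupUnitary G (F (blockPerm σ)) := by
  rw [spectralProj, spectralProj, mul_smul_comm, smul_mul_assoc, Finset.mul_sum, Finset.sum_mul]
  congr 1
  refine Fintype.sum_equiv (Equiv.arrowCongr σ (Equiv.refl _)) _ _ fun a => ?_
  have h1 : (Equiv.arrowCongr σ (Equiv.refl (ZMod K))) a = a ∘ σ.symm := rfl
  rw [h1, comp_equiv_dotProduct_comp_equiv, mul_smul_comm, smul_mul_assoc, shiftUnitary,
    shiftUnitary, ← map_mul, ← map_mul, ← map_mul, ← map_mul, blockPerm_mul_shiftPerm]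

/-- A nontrivial group element has trace zero, so by injectivity of `F` only the zero shift
contributes. -/
lemma groupTrace_spectralProj (hF : Function.Injective F) (s : ι → ZMod K) :
    groupTrace (spectralProj F s) = (Fintype.card (ι → ZMod K) : ℂ)⁻¹ := by
  classical
  rw [spectralProj, map_smul, map_sum, Finset.sum_eq_single 0]
  · rw [map_smul, shiftUnitary, shiftPerm_zero, map_one, groupTrace_groupUnitary]
    simp
  · intro a _ ha
    rw [map_smul, shiftUnitary, groupTrace_groupUnitary, if_neg, smul_zero]
    rwa [← map_one F, hF.eq_iff, shiftPerm_eq_one]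
  · simp

end Spectral

/-! ### Embedding of matrices into the hyperfinite factor -/

section BlockUnitary

variable {ι : Type*} {K : ℕ} {G : Type*} [Group G] (F : Equiv.Perm (ι × ZMod K) →* G)

/-- The unitary of `L(G)` of a permutation of the blocks. -/
def blockUnitary (σ : Equiv.Perm ι) : GroupVN G := groupUnitary G (F (blockPerm σ))

lemma star_blockUnitary_mul_self (σ : Equiv.Perm ι) :
    star (blockUnitary F σ) * blockUnitary F σ = 1 := by
  rw [blockUnitary, star_groupUnitary, ← map_mul, inv_mul_cancel, map_one]

end BlockUnitary

/-! ### Equivalent projections indexed by the position of the maximum -/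

section Blocks

variable {ι : Type*} [Fintype ι] [DecidableEq ι] {K : ℕ} [NeZero K]

open Classical in
/-- The injective functions `ι → ℤ/K` whose largest value is attained at `i`. -/
def maxSet (K : ℕ) [NeZero K] (i : ι) : Finset (ι → ZMod K) :=
  Finset.univ.filter fun s => Function.Injective s ∧ ∀ j, (s j).val ≤ (s i).val

lemma mem_maxSet {i : ι} {s : ι → ZMod K} :
    s ∈ maxSet K i ↔ Function.Injective s ∧ ∀ j, (s j).val ≤ (s i).val := by
  simp [maxSet]

/-- Injectivity excludes ties. The functions that are not injective are discarded, at the price of a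
proportion that vanishes as `K → ∞`. -/
lemma eq_of_mem_maxSet {i j : ι} {s : ι → ZMod K} (hi : s ∈ maxSet K i) (hj : s ∈ maxSet K j) :
    i = j := by
  rw [mem_maxSet] at hi hj
  exact hi.1 (ZMod.val_injective K (le_antisymm (hj.2 i) (hi.2 j)))

lemma comp_symm_mem_maxSet {σ : Equiv.Perm ι} {i : ι} {s : ι → ZMod K} :
    s ∘ σ.symm ∈ maxSet K (σ i) ↔ s ∈ maxSet K i := by
  rw [mem_maxSet, mem_maxSet]
  refine and_congr (Equiv.injective_comp _ _) ?_
  rw [← σ.forall_congr_right]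
  simp

lemma sum_card_maxSet [Nonempty ι] :
    ∑ i : ι, (maxSet K i).card = K.descFactorial (Fintype.card ι) := by
  classical
  rw [← Finset.card_biUnion fun i _ j _ hij => Finset.disjoint_left.2 fun s hi hj =>
    hij (eq_of_mem_maxSet hi hj)]
  have h : Finset.univ.biUnion (maxSet K (ι := ι)) =
      Finset.univ.filter fun s : ι → ZMod K => Function.Injective s := by
    ext s
    simp only [Finset.mem_biUnion, Finset.mem_univ, true_and, mem_maxSet, Finset.mem_filter]
    refine ⟨fun ⟨i, hi⟩ => hi.1, fun hs => ?_⟩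
    obtain ⟨i, hi⟩ := Finite.exists_max fun i => (s i).val
    exact ⟨i, hs, hi⟩
  rw [h, ← Fintype.card_subtype, Fintype.card_congr (Equiv.subtypeInjectiveEquivEmbedding ι (ZMod K)),
    Fintype.card_embedding_eq, ZMod.card]

variable {G : Type*} [Group G] (F : Equiv.Perm (ι × ZMod K) →* G)

/-- The spectral projection of `maxSet K i`. -/
def maxProj (i : ι) : GroupVN G := ∑ s ∈ maxSet K i, spectralProj F s

lemma star_maxProj (i : ι) : star (maxProj F i) = maxProj F i := by
  rw [maxProj, star_sum]
  exact Finset.sum_congr rfl fun s _ => star_spectralProj F s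

lemma maxProj_mul (i j : ι) : maxProj F i * maxProj F j = if i = j then maxProj F i else 0 := by
  simp only [maxProj, Finset.sum_mul_sum, spectralProj_mul]
  split_ifs with hij
  · subst hij
    refine Finset.sum_congr rfl fun s hs => ?_
    rw [Finset.sum_ite_eq, if_pos hs]
  · refine Finset.sum_eq_zero fun s hs => Finset.sum_eq_zero fun t ht => if_neg ?_
    rintro rfl
    exact hij (eq_of_mem_maxSet hs ht)

lemma blockUnitary_mul_maxProj (σ : Equiv.Perm ι) (i : ι) :
    blockUnitary F σ * maxProj F i = maxProj F (σ i) * blockUnitary F σ := by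
  rw [maxProj, maxProj, Finset.mul_sum, Finset.sum_mul]
  refine Finset.sum_equiv (Equiv.arrowCongr σ (Equiv.refl (ZMod K)))
    (fun s => (comp_symm_mem_maxSet (σ := σ)).symm) fun s _ => ?_
  exact blockPerm_mul_spectralProj F σ s

lemma groupTrace_maxProj (hF : Function.Injective F) (i : ι) :
    groupTrace (maxProj F i) = (maxSet K i).card * ((K : ℂ) ^ Fintype.card ι)⁻¹ := by
  rw [maxProj, map_sum, Finset.sum_congr rfl fun s _ => groupTrace_spectralProj F hF s]
  simp [ZMod.card]

lemma groupTrace_maxProj_perm (σ : Equiv.Perm ι) (i : ι) :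
    groupTrace (maxProj F (σ i)) = groupTrace (maxProj F i) := by
  have h : star (blockUnitary F σ) * (maxProj F (σ i) * blockUnitary F σ) = maxProj F i := by
    rw [← blockUnitary_mul_maxProj, ← mul_assoc, star_blockUnitary_mul_self, one_mul]
  have h' : blockUnitary F σ * star (blockUnitary F σ) = 1 := by
    rw [blockUnitary, star_groupUnitary, ← map_mul, mul_inv_cancel, map_one]
  rw [← h, groupTrace_comm, mul_assoc, h', mul_one]

variable (o : ι)

/-- The first column of a system of matrix units of `L(G)`. -/
def blockColumn (i : ι) : GroupVN G := blockUnitary F (Equiv.swap o i) * maxProj F o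

/-- The column entry is a partial isometry from `maxProj F o` to `maxProj F i`; this form shows its
range projection. -/
lemma blockColumn_eq (i : ι) :
    blockColumn F o i = maxProj F i * blockUnitary F (Equiv.swap o i) := by
  rw [blockColumn, blockUnitary_mul_maxProj, Equiv.swap_apply_left]

lemma star_blockColumn_mul (j k : ι) :
    star (blockColumn F o j) * blockColumn F o k = if j = k then maxProj F o else 0 := by
  split_ifs with h
  · subst h
    rw [blockColumn, star_mul, star_maxProj, mul_assoc, ← mul_assoc (star (blockUnitary F _)),
      star_blockUnitary_mul_self, one_mul, maxProj_mul, if_pos rfl]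
  · rw [blockColumn_eq, blockColumn_eq, star_mul, star_maxProj, mul_assoc,
      ← mul_assoc (maxProj F j), maxProj_mul, if_neg h, zero_mul, mul_zero]

lemma blockColumn_mul_maxProj (i : ι) : blockColumn F o i * maxProj F o = blockColumn F o i := by
  rw [blockColumn, mul_assoc, maxProj_mul, if_pos rfl]

/-- The projections are conjugate, so the left side is the trace of their sum. That sum runs over
all injective functions, each contributing `K ^ (-|ι|)`. -/
lemma card_mul_groupTrace_maxProj (hF : Function.Injective F) :
    Fintype.card ι * groupTrace (maxProj F o) =
      K.descFactorial (Fintype.card ι) / (K : ℂ) ^ Fintype.card ι := by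
  have : Nonempty ι := ⟨o⟩
  rw [div_eq_mul_inv, ← sum_card_maxSet (ι := ι), Nat.cast_sum, Finset.sum_mul,
    Finset.sum_congr rfl fun i _ => (groupTrace_maxProj F hF i).symm,
    Finset.sum_congr rfl fun i _ => by
      rw [show maxProj F i = maxProj F (Equiv.swap o i o) by rw [Equiv.swap_apply_left],
        groupTrace_maxProj_perm]]
  simp

end Blocks

/-- The quotient is the proportion of injective functions from `N` points to `n + 1` points. -/
lemma tendsto_descFactorial_div_pow (N : ℕ) :
    Tendsto (fun n : ℕ => ((n + 1).descFactorial N : ℂ) / ((n + 1 : ℕ) : ℂ) ^ N) atTop (𝓝 1) := by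
  induction N with
  | zero => simp
  | succ N ih =>
    have h1 : Tendsto (fun n : ℕ => (((n + 1 - N : ℕ) : ℂ)) / ((n + 1 : ℕ) : ℂ)) atTop (𝓝 1) := by
      have h2 : Tendsto (fun n : ℕ => 1 - (N : ℂ) * ((n : ℂ) + 1)⁻¹) atTop (𝓝 1) := by
        have := (tendsto_one_div_add_atTop_nhds_zero_nat (𝕜 := ℂ)).const_mul (N : ℂ)
        simpa using this.const_sub 1
      refine h2.congr' ?_
      filter_upwards [eventually_ge_atTop N] with n hn
      have h0 : (n : ℂ) + 1 ≠ 0 := by exact_mod_cast n.succ_ne_zero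
      rw [Nat.cast_sub (by omega)]
      push_cast
      field_simp
    have h := h1.mul ih
    rw [mul_one] at h
    refine h.congr fun n => ?_
    rw [Nat.descFactorial_succ, Nat.cast_mul, pow_succ', mul_div_mul_comm]

/-- Matrix algebras embed into the hyperfinite factor, up to a small defect of the trace. -/
theorem exists_embedding (N : ℕ+) : ∃ (φ : ℕ → Mat N →ₗ[ℂ] HyperfiniteR) (c : ℕ → ℂ),
    (∀ n a, φ n (star a) = star (φ n a)) ∧ (∀ n a b, φ n (a * b) = φ n a * φ n b) ∧
    (∀ a, ∃ C : ℝ, ∀ n, ‖φ n a‖ ≤ C) ∧ Tendsto c atTop (𝓝 1) ∧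
    ∀ n a, HyperfiniteR.trace (φ n a) = c n * tauN N a := by
  -- `K = n + 1` is never zero, and the countable set of blocks is placed inside `ℕ`.
  choose f hf using fun n : ℕ => exists_injective_nat (Fin N × ZMod (n + 1))
  let F : ∀ n : ℕ, Equiv.Perm (Fin N × ZMod (n + 1)) →* finitePerm :=
    fun n => finitePermHom ⟨f n, hf n⟩
  have hF : ∀ n, Function.Injective (F n) := fun n => finitePermHom_injective _
  let o : Fin N := ⟨0, N.pos⟩
  have : Nonempty (Fin N) := ⟨o⟩
  refine ⟨fun n => unitSystemMap (A := GroupVN finitePerm) (blockColumn (F n) o),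
    fun n => ((n + 1).descFactorial N : ℂ) / ((n + 1 : ℕ) : ℂ) ^ (N : ℕ),
    fun n a => unitSystemMap_star (A := GroupVN finitePerm) a,
    fun n a b => unitSystemMap_mul (star_blockColumn_mul (F n) o)
      (blockColumn_mul_maxProj (F n) o) a b,
    fun a => ⟨_, fun n => norm_unitSystemMap_le (star_blockColumn_mul (F n) o)
      (blockColumn_mul_maxProj (F n) o) a⟩,
    tendsto_descFactorial_div_pow N, fun n a => ?_⟩
  -- The trace of the image of `a` is `Tr(a) τ(q)`, and `N τ(q)` is the total trace `c n` of the
  -- diagonal units.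
  have h1 := trace_unitSystemMap (star_blockColumn_mul (F n) o) groupTrace groupTrace_comm a
  have h2 := card_mul_groupTrace_maxProj (F n) o (hF n)
  rw [Fintype.card_fin] at h2
  refine h1.trans ?_
  beta_reduce
  rw [← h2]
  have hN : ((N : ℕ) : ℂ) ≠ 0 := by exact_mod_cast N.ne_zero
  simp only [tauN, LinearMap.smul_apply, Matrix.traceLinearMap_apply, smul_eq_mul]
  field_simp

lemma trace_one : HyperfiniteR.trace 1 = 1 := by
  change ⟪deltaOne, (deltaOne : EllTwo finitePerm)⟫_ℂ = 1
  rw [inner_deltaOne, deltaOne_apply, if_pos rfl]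

lemma tauN_one (N : ℕ+) : tauN N 1 = 1 := by
  have hN : ((N : ℕ) : ℂ) ≠ 0 := by exact_mod_cast N.ne_zero
  simp [tauN, hN]

/-- The maps need not be unital, so the empty word is treated apart; on any other word
multiplicativity leaves just the factor `c n`. -/
theorem tendsto_trace_embedding_list {N : ℕ+} {φ : ℕ → Mat N →ₗ[ℂ] HyperfiniteR} {c : ℕ → ℂ}
    (hmul : ∀ n a b, φ n (a * b) = φ n a * φ n b) (hc : Tendsto c atTop (𝓝 1))
    (htr : ∀ n a, HyperfiniteR.trace (φ n a) = c n * tauN N a) (l : List (Mat N)) :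
    Tendsto (fun n => HyperfiniteR.trace (l.map (φ n)).prod) atTop (𝓝 (tauN N l.prod)) := by
  cases l with
  | nil =>
    simp only [List.map_nil, List.prod_nil, trace_one, tauN_one]
    exact tendsto_const_nhds
  | cons a l =>
    have h : ∀ n, ((a :: l).map (φ n)).prod = φ n (a :: l).prod := by
      intro n
      induction l generalizing a with
      | nil => simp
      | cons b l ih => rw [List.map_cons, List.prod_cons, ih, ← hmul, ← List.prod_cons]
    simp only [h, htr]
    simpa using hc.mul_const (tauN N (a :: l).prod)

/-! ### Matrices inside the ultrapower -/

section

variable {m : ℕ}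

/-- Tuples of matrices embed into `ℛ^ω`, and trace polynomials take the same values. -/
theorem exists_ultra_embedding (ω : Ultrafilter ℕ) (hω : (ω : Filter ℕ) ≤ cofinite) (N : ℕ+) :
    ∃ Φ : SaMat m N →ₗ[ℝ] (Fin m → selfAdjoint (UltraR ω)),
      ∀ x (g : TrP0 m), TrP.evalUltra g (Φ x) = TrP.evalMat g x := by
  obtain ⟨φ, c, hstar, hmul, hbound, hc, htr⟩ := exists_embedding N
  let Ψ : Mat N → boundedSeq := fun a => ⟨fun n => φ n a, hbound a⟩
  have hΨ : ∀ a : selfAdjoint (Mat N), UltraR.mk ω (Ψ a) ∈ selfAdjoint (UltraR ω) := by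
    intro a
    rw [selfAdjoint.mem_iff, UltraR.star_mk]
    congr 1
    apply Subtype.ext
    ext1 n
    change star (φ n a) = φ n a
    rw [← hstar, selfAdjoint.mem_iff.1 a.2]
  let Φ : SaMat m N →ₗ[ℝ] (Fin m → selfAdjoint (UltraR ω)) :=
    { toFun := fun x j => ⟨UltraR.mk ω (Ψ (x j)), hΨ (x j)⟩
      map_add' := fun x y => by
        ext1 j
        apply Subtype.ext
        change UltraR.mk ω (Ψ ((x j : Mat N) + y j)) = UltraR.mk ω (Ψ (x j)) + UltraR.mk ω (Ψ (y j))
        rw [← map_add]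
        congr 1
        apply Subtype.ext
        ext1 n
        exact map_add (φ n) _ _
      map_smul' := fun r x => by
        ext1 j
        apply Subtype.ext
        change UltraR.mk ω (Ψ (r • (x j : Mat N))) = r • UltraR.mk ω (Ψ (x j))
        rw [← Complex.coe_smul, ← Complex.coe_smul, ← map_smul]
        congr 1
        apply Subtype.ext
        ext1 n
        exact map_smul (φ n) _ _ }
  refine ⟨Φ, fun x g => ?_⟩
  have h1 := tendsto_eval0_ultra (ω := ω) (fun j => Ψ (x j)) g
  have h2 : Tendsto (fun n => eval0 HyperfiniteR.trace HyperfiniteR.trace_comm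
      (fun j => (Ψ (x j)).1 n) g) atTop (𝓝 (TrP.evalMat g x)) := by
    refine tendsto_eval0 (fun _ => HyperfiniteR.trace) (fun _ => HyperfiniteR.trace_comm) _ _
      (fun n j => (Ψ (x j)).1 n) _ (fun w => ?_) g
    simpa [List.map_map, Function.comp_def] using!
      tendsto_trace_embedding_list hmul hc htr (w.map fun j => (x j : Mat N))
  -- Freeness of `ω` enters here: the trace defect vanishes along `atTop`, and the limit along `ω`
  -- inherits this.
  exact tendsto_nhds_unique h1 (h2.mono_left (hω.trans Nat.cofinite_eq_atTop.le))

/-- The restriction of `f` to matrices is the composition of its values on `ℛ^ω` with a real-linear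
map, by passing to the limit along `approx f`. -/
theorem T01.convexOn_evalMat_of_evalUltra (f : T01 m) (ω : Ultrafilter ℕ)
    (hω : (ω : Filter ℕ) ≤ cofinite)
    (h : ConvexOn ℝ Set.univ (fun X : Fin m → selfAdjoint (UltraR ω) => (f.evalUltra X).re))
    (N : ℕ+) : ConvexOn ℝ Set.univ (fun x : SaMat m N => (f.evalMat x).re) := by
  obtain ⟨Φ, hΦ⟩ := exists_ultra_embedding (m := m) ω hω N
  have key : ∀ x, f.evalUltra (Φ x) = f.evalMat x := fun x =>
    tendsto_nhds_unique ((f.tendsto_evalUltra (Φ x)).congr fun g => hΦ x g) (f.tendsto_evalMat x)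
  have := h.comp_linearMap Φ
  simpa only [Function.comp_def, key, Set.preimage_univ] using! this

end

end FreeGibbs

end

open FreeGibbs
theorem mainTheorem11 (m : ℕ) (ω : Ultrafilter ℕ) (hω : (ω : Filter ℕ) ≤ Filter.cofinite)
    (f : T01 m) (hf : f.IsReal) :
    List.TFAE [
      ∀ N : ℕ+, ConvexOn ℝ Set.univ (fun x : SaMat m N => (f.evalMat x).re),
      ConvexOn ℝ Set.univ (fun x : Fin m → selfAdjoint (UltraR ω) => (f.evalUltra x).re),
      ∃ (V : ∀ N : ℕ+, SaMat m N → ℝ) (DV : ∀ N : ℕ+, SaMat m N → SaMat m N),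
        (∀ N, Differentiable ℝ (V N) ∧ ConvexOn ℝ Set.univ (V N) ∧
          IsNormalizedGradient (V N) (DV N)) ∧
        f.IsRepresentedBy V ∧ f.IsGradRepresentedBy DV] := by
  tfae_have 1 → 2 := f.convexOn_evalUltra ω
  tfae_have 2 → 1 := f.convexOn_evalMat_of_evalUltra ω hω
  tfae_have 1 → 3 := fun h =>
    ⟨fun _ x => (f.evalMat x).re, f.gradSa hf, fun N =>
      ⟨fun x => (f.hasFDerivAt_re_evalMat x).differentiableAt, h N,
        f.isNormalizedGradient_gradSa hf N⟩,
      f.isRepresentedBy_re hf, f.isGradRepresentedBy_gradSa hf⟩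
  tfae_have 3 → 1 := fun ⟨_, _, hV, h, _⟩ =>
    f.convexOn_evalMat_of_isRepresentedBy (fun N => (hV N).2.1) h
  tfae_finish
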